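/- Let $K\in\mathbb R$, $C_g>0$, $V_u\ge 0$. There is a constant $L_0>0$, depending only on $K,C_g,V_u$, such that the following holds. Let $\mathscr X$ be a Banach space, $\mathscr A,\mathscr C:\mathbb R\to\mathscr B(\mathscr X)$, and let $u:\mathbb R\to\mathbb R$ be nondecreasing, left-continuous and of bounded variation with $\sup_{c<d}\mathrm{var}_c^d u=V_u$; write $du$ for its Lebesgue–Stieltjes measure, with $\int_c^d$ with respect to $du$ taken over $[c,d)$ for $c\le d$. Assume that $\int_c^d\mathscr A(s)\,ds$ (Perron) and $\int_c^d\mathscr C(s)\,du(s)$ (Perron–Stieltjes) exist for all $c,d\in\mathbb R$, and that there are real functions $m_1$, locally Lebesgue integrable, and $m_2$, locally $du$-integrable, with $$\Big\|\int_c^d\mathscr A(s)\,ds\Big\|\le\int_c^d m_1(s)\,ds,\qquad \Big\|\int_c^d\mathscr C(s)\,du(s)\Big\|\le\int_c^d m_2(s)\,du(s)\qquad(c\le d).$$ Suppose that the linear measure differential equation $Dx=\mathscr A(t)x+\mathscr C(t)x\,Du$ has an exponential dichotomy on $\mathbb R$: there are a bounded projection $P$ on $\mathscr X$ and a constant $\alpha>0$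 such that, with $K>0$ as above and $\mathscr U(t)=U(t,0)$, $\mathscr U^{-1}(t)=U(0,t)$, where $U:\mathbb R\times\mathbb R\to\mathscr B(\mathscr X)$ is the fundamental operator $$U(t,s)=I+\int_s^t\mathscr A(r)U(r,s)\,dr+\int_s^t\mathscr C(r)U(r,s)\,du(r),$$ one has $$\|\mathscr U(t)P\,\mathscr U^{-1}(s)\|\le Ke^{-\alpha(t-s)}\ (t\ge s),\qquad \|\mathscr U(t)(I-P)\,\mathscr U^{-1}(s)\|\le Ke^{\alpha(t-s)}\ (t\le s).$$ Suppose further that: (a) at every point $t$ of discontinuity of $u$ the operator $I+\lim_{r\to t^+}\int_t^r\mathscr C(s)\,du(s)$ is invertible in $\mathscr B(\mathscr X)$, and its inverse has norm at most $C_g$; (b) $\mathscr H:\mathbb R\times\mathscr X\to\mathscr X$ satisfies $\mathscr H(t,0)=0$ for all $t$, and for every $x\in\mathscr X$ the function $t\mapsto\mathscr H(t,x)$ is Lebesgue–Stieltjes integrable with respect to $u$ on bounded intervals; (c) there is $M_h>0$ with $\|\mathscr H(t,x)\|\le M_h$ for all $t\in\mathbb R$, $x\in\mathscr X$; (d) there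 is $L_h\ge0$ with $\|\mathscr H(t,x)-\mathscr H(t,\tilde x)\|\le L_h\|x-\tilde x\|$ for all $t\in\mathbb R$, $x,\tilde x\in\mathscr X$, and $L_h$ is small in the sense that at least one of the following holds: * $L_h\le L_0$; * for all $c<d$, with $v=\mathrm{var}_c^d\Big(t\mapsto\int_0^t\mathscr A(s)\,ds+\int_0^t\mathscr C(s)\,du(s)\Big)$, $$2L_hV_u\big(1+K(1+2K)\,C_g^3\,e^{3C_gv}\,v^2\big)<1 .$$ Then the nonlinear measure differential equation $Dx=\mathscr A(t)x+\mathscr C(t)x\,Du+\mathscr H(t,x)\,Du$ has a unique bounded solution on $\mathbb R$, that is, there is exactly one bounded function $x:\mathbb R\to\mathscr X$ such that for all $t_0,t\in\mathbb R$ the following integrals (Perron, Perron–Stieltjes and Lebesgue–Stieltjes, respectively) exist and $$x(t)=x(t_0)+\int_{t_0}^t\mathscr A(s)x(s)\,ds+\int_{t_0}^t\mathscr C(s)x(s)\,du(s)+\int_{t_0}^t\mathscr H(s,x(s))\,du(s).$$ -/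

import Mathlib

open Set Filter Topology MeasureTheory

noncomputable section

/-- The points `s 0 ≤ s 1 ≤ … ≤ s n` with tags `τ i ∈ [s i, s (i+1)]` form a tagged division of
`[a, b]` which is fine for the gauge `δ`. -/
def IsFineDivision (δ : ℝ → ℝ) (a b : ℝ) (n : ℕ) (s τ : ℕ → ℝ) : Prop :=
  s 0 = a ∧ s n = b ∧
    ∀ i < n, s i ≤ τ i ∧ τ i ≤ s (i + 1) ∧
      Icc (s i) (s (i + 1)) ⊆ Ioo (τ i - δ (τ i)) (τ i + δ (τ i))

/-- `J` is the Kurzweil integral `∫_a^b DV(τ,t)`, for `a ≤ b`. -/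
def HasKurzweilIntegral {E : Type*} [NormedAddCommGroup E] (V : ℝ → ℝ → E) (a b : ℝ) (J : E) :
    Prop :=
  ∀ ε > 0, ∃ δ : ℝ → ℝ, (∀ t, 0 < δ t) ∧
    ∀ (n : ℕ) (s τ : ℕ → ℝ), IsFineDivision δ a b n s τ →
      ‖∑ i ∈ Finset.range n, (V (τ i) (s (i + 1)) - V (τ i) (s i)) - J‖ < ε

/-- `J` is the oriented Perron-Stieltjes integral `∫_a^b f(s) du(s)`, i.e. the Kurzweil integral
with Riemann-Stieltjes sums `∑ (u(s_{j+1}) - u(s_j)) f(τ_j)`.  For `u = id` it is the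
Perron integral `∫_a^b f(s) ds`. -/
def HasPSIntegral {E : Type*} [NormedAddCommGroup E] [NormedSpace ℝ E]
    (f : ℝ → E) (u : ℝ → ℝ) (a b : ℝ) (J : E) : Prop :=
  (a ≤ b ∧ HasKurzweilIntegral (fun τ t => u t • f τ) a b J) ∨
    (b < a ∧ HasKurzweilIntegral (fun τ t => u t • f τ) b a (-J))

/-- Existence of the oriented Perron-Stieltjes integral `∫_a^b f(s) du(s)`. -/
def PSIntegrable {E : Type*} [NormedAddCommGroup E] [NormedSpace ℝ E]
    (f : ℝ → E) (u : ℝ → ℝ) (a b : ℝ) : Prop :=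
  ∃ J, HasPSIntegral f u a b J

open Classical in
/-- The value of the oriented Perron-Stieltjes integral `∫_a^b f(s) du(s)`
(and `0` if it does not exist). -/
def psIntegral {E : Type*} [NormedAddCommGroup E] [NormedSpace ℝ E]
    (f : ℝ → E) (u : ℝ → ℝ) (a b : ℝ) : E :=
  if h : PSIntegrable f u a b then h.choose else 0

/-- The Lebesgue-Stieltjes measure `du` of a nondecreasing function `u`; it gives `[a, b)` the mass
`u(b) - u(a)` when `u` is left-continuous. -/
def duMeasure (u : ℝ → ℝ) (hu : Monotone u) : Measure ℝ :=
  hu.stieltjesFunction.measure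

/-- The oriented Lebesgue-Stieltjes (Bochner) integral `∫_a^b f dμ`, over `[a, b)` if `a ≤ b` and
minus the integral over `[b, a)` if `b ≤ a`. -/
def lsIntegral {E : Type*} [NormedAddCommGroup E] [NormedSpace ℝ E]
    (f : ℝ → E) (μ : Measure ℝ) (a b : ℝ) : E :=
  (∫ s in Ico a b, f s ∂μ) - ∫ s in Ico b a, f s ∂μ

/-- `sup {var_c^d g : c < d}`. -/
def totalVariation {E : Type*} [NormedAddCommGroup E] (g : ℝ → E) : ENNReal :=
  ⨆ (c : ℝ) (d : ℝ) (_ : c < d), eVariationOn g (Icc c d)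

section MDE

variable {X : Type*} [NormedAddCommGroup X] [NormedSpace ℝ X]

/-- The standing conditions on the coefficients of `Dx = A(t)x + C(t)x Du` on `ℝ`,
for a nondecreasing `u`. -/
structure IsAdmissible (A C : ℝ → X →L[ℝ] X) (u : ℝ → ℝ) (hu : Monotone u) : Prop where
  perron_integrable : ∀ c d, PSIntegrable A id c d
  left_continuous : ∀ t, ContinuousWithinAt u (Iic t) t
  perronStieltjes_integrable : ∀ c d, PSIntegrable C u c d
  bound_A : ∃ m₁ : ℝ → ℝ, ∀ c d, c ≤ d →
    IntegrableOn m₁ (Ico c d) volume ∧ ‖psIntegral A id c d‖ ≤ ∫ s in Ico c d, m₁ s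
  bound_C : ∃ m₂ : ℝ → ℝ, ∀ c d, c ≤ d →
    IntegrableOn m₂ (Ico c d) (duMeasure u hu) ∧
      ‖psIntegral C u c d‖ ≤ ∫ s in Ico c d, m₂ s ∂(duMeasure u hu)
  jump : ∀ t, ¬ ContinuousAt u t →
    ∃ J : X →L[ℝ] X, Tendsto (fun r => psIntegral C u t r) (𝓝[>] t) (𝓝 J) ∧ IsUnit (1 + J)

/-- `U` is the fundamental operator of `Dx = A(t)x + C(t)x Du`:
`U(t,s) = I + ∫_s^t A(r)U(r,s) dr + ∫_s^t C(r)U(r,s) du(r)`. -/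
def IsFundamentalOperator (A C : ℝ → X →L[ℝ] X) (u : ℝ → ℝ) (U : ℝ → ℝ → X →L[ℝ] X) : Prop :=
  ∀ t s, PSIntegrable (fun r => A r * U r s) id s t ∧ PSIntegrable (fun r => C r * U r s) u s t ∧
    U t s = 1 + psIntegral (fun r => A r * U r s) id s t
      + psIntegral (fun r => C r * U r s) u s t

/-- `Dx = A(t)x + C(t)x Du` has an exponential dichotomy with `(P, K, α)` on `ℝ`. -/
def HasExponentialDichotomy (A C : ℝ → X →L[ℝ] X) (u : ℝ → ℝ) (P : X →L[ℝ] X) (K α : ℝ) : Prop :=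
  P * P = P ∧ 0 < K ∧ 0 < α ∧
    ∃ U : ℝ → ℝ → X →L[ℝ] X, IsFundamentalOperator A C u U ∧
      (∀ t s, s ≤ t → ‖U t 0 * P * U 0 s‖ ≤ K * Real.exp (-α * (t - s))) ∧
      (∀ t s, t ≤ s → ‖U t 0 * (1 - P) * U 0 s‖ ≤ K * Real.exp (α * (t - s)))

/-- The inverse jump operators `(I + lim_{r → t+} ∫_t^r C du)⁻¹`, at the discontinuities `t` of `u`,
are bounded by `Cg`. -/
def InverseJumpsBounded (C : ℝ → X →L[ℝ] X) (u : ℝ → ℝ) (Cg : ℝ) : Prop :=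
  ∀ t, ¬ ContinuousAt u t →
    ∀ J : X →L[ℝ] X, Tendsto (fun r => psIntegral C u t r) (𝓝[>] t) (𝓝 J) →
      ‖Ring.inverse (1 + J)‖ ≤ Cg

/-- The conditions on the perturbation `H` with bound `M` and Lipschitz constant `L`. -/
structure IsPerturbation (H : ℝ → X → X) (u : ℝ → ℝ) (hu : Monotone u) (M L : ℝ) : Prop where
  integrable : ∀ x c d, IntegrableOn (fun t => H t x) (Ico c d) (duMeasure u hu)
  map_zero : ∀ t, H t 0 = 0
  bounded : ∀ t x, ‖H t x‖ ≤ M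
  lipschitz : ∀ t x y, ‖H t x - H t y‖ ≤ L * ‖x - y‖

/-- `x : ℝ → X` is a solution on `ℝ` of `Dx = A(t)x + C(t)x Du + H(t,x) Du`. -/
def IsSolution (A C : ℝ → X →L[ℝ] X) (H : ℝ → X → X) (u : ℝ → ℝ) (hu : Monotone u)
    (x : ℝ → X) : Prop :=
  ∀ t₀ t, PSIntegrable (fun s => A s (x s)) id t₀ t ∧ PSIntegrable (fun s => C s (x s)) u t₀ t ∧
    IntegrableOn (fun s => H s (x s)) (uIcc t₀ t) (duMeasure u hu) ∧
    x t = x t₀ + psIntegral (fun s => A s (x s)) id t₀ t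
      + psIntegral (fun s => C s (x s)) u t₀ t
      + lsIntegral (fun s => H s (x s)) (duMeasure u hu) t₀ t

/-- The primitive `t ↦ ∫_0^t A(s) ds + ∫_0^t C(s) du(s)` of the coefficients. -/
def coeffPrimitive (A C : ℝ → X →L[ℝ] X) (u : ℝ → ℝ) (t : ℝ) : X →L[ℝ] X :=
  psIntegral A id 0 t + psIntegral C u 0 t

end MDE

end

/-! The bounded solution is the fixed point of a contraction. For a bounded measurable forcing `f`,
the dichotomy provides the Green operator `T f t = U t 0 (∫_{s<t} P W(s) f(s) du(s) - ∫_{s≥t} (1 -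
P) W(s) f(s) du(s))`. Here `W s` is the right limit of `U 0 r` as `r → s+`: a point mass of `du` at
`s` acts only after time `s`. Both kernels `U t 0 * P * W s` and `U t 0 * (1 - P) * W s` have norm
at most `K` and `du` has total mass at most `Vu`, so `‖T f‖ ≤ K Vu sup ‖f‖` (`norm_green_le`).
Exponential decay serves for uniqueness: a bounded homogeneous solution has no stable and no
unstable part at time `0` (`bounded_eq_zero`). Bounded solutions are therefore the fixed points of
`x ↦ T (H(·, x))`, a contraction when `K Vu Lh < 1`, and `L₀` is chosen to ensure this.

Under the second smallness condition, either `Lh Vu = 0`, and the contraction factor vanishes, or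
the variation of the primitive of the coefficients is bounded uniformly over all intervals. In that
case the variation left near `±∞` is at most `1/2`, so a solution tending to `0` there is bounded on
the tail by half of any bound for it, hence is zero. Stable and unstable initial vectors all vanish,
and `X` is trivial (`subsingleton_of_variation_le`).

The coefficients are only Perron integrable, with no integrability of their norms, and two tools
make up for this. First, a scalar function whose primitive is dominated by `∫ m` is itself dominated
by `m` almost everywhere (`ae_abs_le`). Norming functionals and values at rational points turn this
into `‖∫ B y‖ ≤ sup ‖y‖ ∫ m` (`norm_hasStieltjes_clm_le`), from which follow uniqueness for the
linear equation (`eq_zero`) and the cocycle law of `U`. Second, integration by parts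
(`hasStieltjes_clm_apply`), obtained from the Saks-Henstock lemma and Abel summation, shows that `T
f` solves the forced equation (`isForcedSolution_green`). -/

noncomputable section

/-! ### Fine tagged divisions and their sums -/

/-- The tagged interval `(τ, [s, s'])` is fine for the gauge `δ`. -/
def IsFineCell (δ : ℝ → ℝ) (τ s s' : ℝ) : Prop :=
  s ≤ τ ∧ τ ≤ s' ∧ Icc s s' ⊆ Ioo (τ - δ τ) (τ + δ τ)

theorem IsFineCell.le {δ : ℝ → ℝ} {τ s s' : ℝ} (h : IsFineCell δ τ s s') : s ≤ s' :=
  h.1.trans h.2.1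

theorem IsFineCell.mono {δ δ' : ℝ → ℝ} {τ s s' : ℝ} (h : IsFineCell δ τ s s')
    (hd : ∀ t, δ t ≤ δ' t) : IsFineCell δ' τ s s' :=
  ⟨h.1, h.2.1, h.2.2.trans (Ioo_subset_Ioo (by linarith [hd τ]) (by linarith [hd τ]))⟩

theorem isFineCell_of_lt {δ : ℝ → ℝ} {τ s s' : ℝ} (h1 : s ≤ τ) (h2 : τ ≤ s')
    (h3 : τ - δ τ < s) (h4 : s' < τ + δ τ) : IsFineCell δ τ s s' :=
  ⟨h1, h2, fun _ hx => ⟨h3.trans_le hx.1, hx.2.trans_lt h4⟩⟩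

theorem IsFineCell.lt_left {δ : ℝ → ℝ} {τ s s' : ℝ} (h : IsFineCell δ τ s s') : τ - δ τ < s :=
  (h.2.2 ⟨le_rfl, h.le⟩).1

theorem IsFineCell.lt_right {δ : ℝ → ℝ} {τ s s' : ℝ} (h : IsFineCell δ τ s s') : s' < τ + δ τ :=
  (h.2.2 ⟨h.le, le_rfl⟩).2

/-- `S` is the sum of `g τ s s'` over the cells of some `δ`-fine tagged division of `[a, b]`. -/
inductive IsFineSum {E : Type*} [AddCommGroup E] (δ : ℝ → ℝ) (g : ℝ → ℝ → ℝ → E) (a : ℝ) :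
    ℝ → E → Prop
  | nil : IsFineSum δ g a a 0
  | snoc {b c τ : ℝ} {S : E} : IsFineSum δ g a b S → IsFineCell δ τ b c →
      IsFineSum δ g a c (S + g τ b c)

section FineSum

variable {E : Type*} [AddCommGroup E] {δ δ' : ℝ → ℝ} {g : ℝ → ℝ → ℝ → E} {a b c : ℝ} {S T : E}

theorem IsFineSum.le (h : IsFineSum δ g a b S) : a ≤ b := by
  induction h with
  | nil => exact le_rfl
  | snoc _ hc ih => exact ih.trans hc.le

theorem IsFineSum.mono (h : IsFineSum δ g a b S) (hd : ∀ t, δ t ≤ δ' t) :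
    IsFineSum δ' g a b S := by
  induction h with
  | nil => exact .nil
  | snoc _ hc ih => exact ih.snoc (hc.mono hd)

theorem IsFineCell.isFineSum {τ s s' : ℝ} (h : IsFineCell δ τ s s') :
    IsFineSum δ g s s' (g τ s s') := by
  simpa using (IsFineSum.nil (δ := δ) (g := g) (a := s)).snoc h

theorem IsFineSum.trans (h : IsFineSum δ g a b S) (h' : IsFineSum δ g b c T) :
    IsFineSum δ g a c (S + T) := by
  induction h' with
  | nil => simpa using h
  | snoc _ hc ih => rw [← add_assoc]; exact ih.snoc hc

/-- Passes between indexed divisions, used in the definition of the integral, and the inductive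
form, which makes concatenation and splitting easy. -/
theorem isFineSum_iff : IsFineSum δ g a b S ↔ ∃ (n : ℕ) (s τ : ℕ → ℝ),
    IsFineDivision δ a b n s τ ∧ S = ∑ i ∈ Finset.range n, g (τ i) (s i) (s (i + 1)) := by
  constructor
  · intro h
    induction h with
    | nil => exact ⟨0, fun _ => a, fun _ => a, ⟨rfl, rfl, by simp⟩, by simp⟩
    | @snoc b c t S _ hc ih =>
      obtain ⟨n, s, τ, ⟨h0, hn, hf⟩, rfl⟩ := ih
      refine ⟨n + 1, fun i => if i ≤ n then s i else c, fun i => if i < n then τ i else t,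
        ⟨by simp [h0], by simp, ?_⟩, ?_⟩
      · intro i hi
        rcases Nat.lt_succ_iff_lt_or_eq.1 hi with hi | rfl
        · simpa [hi, hi.le, Nat.succ_le_of_lt hi] using hf i hi
        · simpa [hn] using (show b ≤ t ∧ t ≤ c ∧ _ from hc)
      · rw [Finset.sum_range_succ]
        congr 1
        · refine Finset.sum_congr rfl fun i hi => ?_
          have hi := Finset.mem_range.1 hi
          simp [hi, hi.le, Nat.succ_le_of_lt hi]
        · simp [hn]
  · rintro ⟨n, s, τ, ⟨h0, hn, hf⟩, rfl⟩
    subst h0 hn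
    have key : ∀ k ≤ n, IsFineSum δ g (s 0) (s k)
        (∑ i ∈ Finset.range k, g (τ i) (s i) (s (i + 1))) := by
      intro k
      induction k with
      | zero => intro _; simpa using IsFineSum.nil
      | succ k ih =>
        intro hk
        rw [Finset.sum_range_succ]
        exact (ih (by omega)).snoc (hf k (by omega))
    exact key n le_rfl

/-- Cousin's lemma. Let `c` be the supremum of the points reachable from `a`. A cell tagged at `c`
reaches `c` from a nearby reachable point, and a second one goes beyond `c` unless `c = b`. -/
theorem exists_isFineSum (hδ : ∀ t, 0 < δ t) (g : ℝ → ℝ → ℝ → E) (hab : a ≤ b) :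
    ∃ S, IsFineSum δ g a b S := by
  set R := {t | t ≤ b ∧ ∃ S, IsFineSum δ g a t S} with hR
  have haR : a ∈ R := ⟨hab, 0, .nil⟩
  have hbd : BddAbove R := ⟨b, fun t ht => ht.1⟩
  set c := sSup R with hc
  have hcb : c ≤ b := csSup_le ⟨a, haR⟩ fun t ht => ht.1
  obtain ⟨t, htR, htc⟩ := exists_lt_of_lt_csSup ⟨a, haR⟩ (show c - δ c < sSup R by
    linarith [hδ c])
  have htle : t ≤ c := le_csSup hbd htR
  obtain ⟨-, S, hS⟩ := htR
  have hSc := hS.snoc (isFineCell_of_lt htle le_rfl htc (by linarith [hδ c]))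
  rcases hcb.eq_or_lt with h | h
  · exact ⟨_, h ▸ hSc⟩
  · have hd := hδ c
    have hm : min b (c + δ c / 2) ∈ R := by
      refine ⟨min_le_left _ _, _, hSc.snoc (τ := c) (isFineCell_of_lt le_rfl ?_ ?_ ?_)⟩
      · exact le_min hcb (by linarith)
      · linarith
      · exact (min_le_right _ _).trans_lt (by linarith)
    have := le_csSup hbd hm
    have : c < min b (c + δ c / 2) := lt_min h (by linarith)
    linarith

/-- A division which is fine for a gauge forcing `b` to be a tag splits at `b`. -/
theorem IsFineSum.split (h : IsFineSum δ g a c S) (hδ : ∀ t, t ≠ b → δ t ≤ |t - b|)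
    (hg : ∀ s s', g b s s' = g b s b + g b b s') (hab : a ≤ b) (hbc : b ≤ c) :
    ∃ S₁ S₂, IsFineSum δ g a b S₁ ∧ IsFineSum δ g b c S₂ ∧ S = S₁ + S₂ := by
  induction h with
  | nil =>
    obtain rfl := le_antisymm hab hbc
    exact ⟨0, 0, .nil, .nil, by simp⟩
  | @snoc p q τ S hS hc ih =>
    rcases le_or_gt b p with hbp | hbp
    · obtain ⟨S₁, S₂, h1, h2, rfl⟩ := ih hbp
      exact ⟨S₁, S₂ + g τ p q, h1, h2.snoc hc, by rw [add_assoc]⟩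
    · have hτ : τ = b := by
        by_contra hne
        have h1 := hc.2.2 ⟨hbp.le, hbc⟩
        have h2 := hδ τ hne
        rcases abs_cases (τ - b) with ⟨h3, _⟩ | ⟨h3, _⟩ <;> linarith [h1.1, h1.2]
      subst hτ
      refine ⟨S + g τ p τ, g τ τ q, hS.snoc ⟨hc.1, le_rfl, fun x hx => hc.2.2 ⟨hx.1, hx.2.trans hc.2.1⟩⟩,
        IsFineCell.isFineSum ⟨le_rfl, hc.2.1, fun x hx => hc.2.2 ⟨hc.1.trans hx.1, hx.2⟩⟩, ?_⟩
      rw [hg, add_assoc]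

end FineSum

/-! ### Perron-Stieltjes integrals and their primitives -/

section Stieltjes

variable {E F : Type*} [NormedAddCommGroup E] [NormedSpace ℝ E] [NormedAddCommGroup F]
  [NormedSpace ℝ F] {f f' : ℝ → E} {v : ℝ → ℝ} {a b c : ℝ} {J J' : E}

/-- `J` is the (non-oriented) Perron-Stieltjes integral `∫_a^b f dv`. -/
abbrev HasStieltjes (f : ℝ → E) (v : ℝ → ℝ) (a b : ℝ) (J : E) : Prop :=
  HasKurzweilIntegral (fun τ t => v t • f τ) a b J

/-- The summand of a Riemann-Stieltjes sum. -/
abbrev stieltjesCell (f : ℝ → E) (v : ℝ → ℝ) (τ s s' : ℝ) : E := (v s' - v s) • f τ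

theorem hasStieltjes_iff : HasStieltjes f v a b J ↔ ∀ ε > 0, ∃ δ : ℝ → ℝ, (∀ t, 0 < δ t) ∧
    ∀ S, IsFineSum δ (stieltjesCell f v) a b S → ‖S - J‖ < ε := by
  refine forall₂_congr fun ε _ => exists_congr fun δ => and_congr_right fun _ => ?_
  constructor
  · rintro h S hS
    obtain ⟨n, s, τ, hd, rfl⟩ := isFineSum_iff.1 hS
    simpa [stieltjesCell, sub_smul] using h n s τ hd
  · intro h n s τ hd
    simpa [stieltjesCell, sub_smul] using h _ (isFineSum_iff.2 ⟨n, s, τ, hd, rfl⟩)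

theorem HasStieltjes.unique (hab : a ≤ b) (h : HasStieltjes f v a b J)
    (h' : HasStieltjes f v a b J') : J = J' := by
  refine eq_of_forall_dist_le fun ε hε => ?_
  obtain ⟨δ, hδ, H⟩ := hasStieltjes_iff.1 h (ε / 2) (by positivity)
  obtain ⟨δ', hδ', H'⟩ := hasStieltjes_iff.1 h' (ε / 2) (by positivity)
  obtain ⟨S, hS⟩ := exists_isFineSum (δ := fun t => min (δ t) (δ' t))
    (fun t => lt_min (hδ t) (hδ' t)) (stieltjesCell f v) hab
  have h1 := H S (hS.mono fun t => min_le_left _ _)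
  have h2 := H' S (hS.mono fun t => min_le_right _ _)
  rw [dist_eq_norm, show J - J' = (S - J') - (S - J) by abel]
  exact (norm_sub_le _ _).trans (by linarith)

theorem IsFineDivision.mono {δ δ' : ℝ → ℝ} {n : ℕ} {s τ : ℕ → ℝ} (h : IsFineDivision δ a b n s τ)
    (hd : ∀ t, δ t ≤ δ' t) : IsFineDivision δ' a b n s τ :=
  ⟨h.1, h.2.1, fun i hi => IsFineCell.mono (δ := δ) (h.2.2 i hi) hd⟩

theorem HasStieltjes.add (h : HasStieltjes f v a b J) (h' : HasStieltjes f' v a b J') :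
    HasStieltjes (fun t => f t + f' t) v a b (J + J') := by
  intro ε hε
  obtain ⟨δ, hδ, H⟩ := h (ε / 2) (by positivity)
  obtain ⟨δ', hδ', H'⟩ := h' (ε / 2) (by positivity)
  refine ⟨fun t => min (δ t) (δ' t), fun t => lt_min (hδ t) (hδ' t), fun n s τ hd => ?_⟩
  have h1 := H n s τ (hd.mono fun t => min_le_left _ _)
  have h2 := H' n s τ (hd.mono fun t => min_le_right _ _)
  have : ∀ x y : E, ‖x + y‖ < ε ∨ ¬ (‖x‖ < ε / 2 ∧ ‖y‖ < ε / 2) := by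
    intro x y
    by_cases hx : ‖x‖ < ε / 2 ∧ ‖y‖ < ε / 2
    · left; linarith [norm_add_le x y]
    · right; exact hx
  have h3 := (this _ _).resolve_right (not_not.2 ⟨h1, h2⟩)
  convert h3 using 2
  simp only [smul_add, Finset.sum_sub_distrib, Finset.sum_add_distrib]
  abel

theorem HasStieltjes.map (L : E →L[ℝ] F) (h : HasStieltjes f v a b J) :
    HasStieltjes (fun t => L (f t)) v a b (L J) := by
  intro ε hε
  have hL : 0 < ‖L‖ + 1 := by positivity
  obtain ⟨δ, hδ, H⟩ := h (ε / (‖L‖ + 1)) (by positivity)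
  refine ⟨δ, hδ, fun n s τ hd => ?_⟩
  have h1 := H n s τ hd
  rw [lt_div_iff₀ hL] at h1
  refine lt_of_le_of_lt ?_ h1
  rw [show (∑ i ∈ Finset.range n, (v (s (i + 1)) • L (f (τ i)) - v (s i) • L (f (τ i))) - L J)
    = L (∑ i ∈ Finset.range n, (v (s (i + 1)) • f (τ i) - v (s i) • f (τ i)) - J) by simp]
  refine (L.le_opNorm _).trans ?_
  rw [mul_comm]
  gcongr
  linarith

theorem HasStieltjes.neg (h : HasStieltjes f v a b J) :
    HasStieltjes (fun t => - f t) v a b (-J) := by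
  simpa using h.map (-ContinuousLinearMap.id ℝ E)

theorem HasStieltjes.sub (h : HasStieltjes f v a b J) (h' : HasStieltjes f' v a b J') :
    HasStieltjes (fun t => f t - f' t) v a b (J - J') := by
  simpa [sub_eq_add_neg] using h.add h'.neg

theorem HasStieltjes.trans (hab : a ≤ b) (hbc : b ≤ c) (h : HasStieltjes f v a b J)
    (h' : HasStieltjes f v b c J') : HasStieltjes f v a c (J + J') := by
  rw [hasStieltjes_iff] at *
  intro ε hε
  obtain ⟨δ, hδ, H⟩ := h (ε / 2) (by positivity)
  obtain ⟨δ', hδ', H'⟩ := h' (ε / 2) (by positivity)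
  set η : ℝ → ℝ := fun t => min (min (δ t) (δ' t)) (if t = b then 1 else |t - b|) with hη
  refine ⟨η, fun t => ?_, fun S hS => ?_⟩
  · refine lt_min (lt_min (hδ t) (hδ' t)) ?_
    split_ifs with ht
    · exact one_pos
    · exact abs_pos.2 (sub_ne_zero.2 ht)
  · obtain ⟨S₁, S₂, h1, h2, rfl⟩ := hS.split (b := b)
      (fun t ht => (min_le_right _ _).trans (by simp [ht]))
      (fun s s' => by simp only [stieltjesCell, ← add_smul]; congr 1; ring) hab hbc
    have h3 := H _ (h1.mono fun t => (min_le_left _ _).trans (min_le_left _ _))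
    have h4 := H' _ (h2.mono fun t => (min_le_left _ _).trans (min_le_right _ _))
    rw [add_sub_add_comm]
    exact (norm_add_le _ _).trans_lt (by linarith)

/-- Prefixing a fine division of `[a, b]` to one of `[b, c]` gives a fine division of `[a, c]`. As
both integrals are given, no Cauchy criterion is needed. -/
theorem HasStieltjes.of_left (hab : a ≤ b) (h : HasStieltjes f v a b J)
    (h' : HasStieltjes f v a c J') : HasStieltjes f v b c (J' - J) := by
  rw [hasStieltjes_iff] at *
  intro ε hε
  obtain ⟨δ, hδ, H⟩ := h (ε / 2) (by positivity)
  obtain ⟨δ', hδ', H'⟩ := h' (ε / 2) (by positivity)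
  refine ⟨fun t => min (δ t) (δ' t), fun t => lt_min (hδ t) (hδ' t), fun S hS => ?_⟩
  obtain ⟨T, hT⟩ := exists_isFineSum (δ := fun t => min (δ t) (δ' t))
    (fun t => lt_min (hδ t) (hδ' t)) (stieltjesCell f v) hab
  have h1 := H T (hT.mono fun t => min_le_left _ _)
  have h2 := H' _ ((hT.trans hS).mono fun t => min_le_right _ _)
  rw [show S - (J' - J) = (T + S - J') - (T - J) by abel]
  exact (norm_sub_le _ _).trans_lt (by linarith)

theorem HasStieltjes.of_right (hbc : b ≤ c) (h : HasStieltjes f v b c J)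
    (h' : HasStieltjes f v a c J') : HasStieltjes f v a b (J' - J) := by
  rw [hasStieltjes_iff] at *
  intro ε hε
  obtain ⟨δ, hδ, H⟩ := h (ε / 2) (by positivity)
  obtain ⟨δ', hδ', H'⟩ := h' (ε / 2) (by positivity)
  refine ⟨fun t => min (δ t) (δ' t), fun t => lt_min (hδ t) (hδ' t), fun S hS => ?_⟩
  obtain ⟨T, hT⟩ := exists_isFineSum (δ := fun t => min (δ t) (δ' t))
    (fun t => lt_min (hδ t) (hδ' t)) (stieltjesCell f v) hbc
  have h1 := H T (hT.mono fun t => min_le_left _ _)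
  have h2 := H' _ ((hS.trans hT).mono fun t => min_le_right _ _)
  rw [show S - (J' - J) = (S + T - J') - (T - J) by abel]
  exact (norm_sub_le _ _).trans_lt (by linarith)

/-- `Φ` is an indefinite Perron-Stieltjes integral of `f dv` on `ℝ`. -/
def HasPrimitive (f : ℝ → E) (v : ℝ → ℝ) (Φ : ℝ → E) : Prop :=
  ∀ p q, p ≤ q → HasStieltjes f v p q (Φ q - Φ p)

theorem HasPSIntegral.unique (h : HasPSIntegral f v a b J) (h' : HasPSIntegral f v a b J') :
    J = J' := by
  rcases h with ⟨hab, h⟩ | ⟨hab, h⟩ <;> rcases h' with ⟨hab', h'⟩ | ⟨hab', h'⟩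
  · exact HasStieltjes.unique hab h h'
  · linarith
  · linarith
  · exact neg_injective (HasStieltjes.unique hab.le h h')

theorem HasPSIntegral.psIntegral_eq (h : HasPSIntegral f v a b J) : psIntegral f v a b = J := by
  have hi : PSIntegrable f v a b := ⟨J, h⟩
  rw [psIntegral, dif_pos hi]
  exact hi.choose_spec.unique h

theorem PSIntegrable.hasPSIntegral (h : PSIntegrable f v a b) :
    HasPSIntegral f v a b (psIntegral f v a b) := by
  rw [psIntegral, dif_pos h]
  exact h.choose_spec

theorem HasPrimitive.hasPSIntegral {Φ : ℝ → E} (h : HasPrimitive f v Φ) (a b : ℝ) :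
    HasPSIntegral f v a b (Φ b - Φ a) := by
  rcases le_or_gt a b with hab | hab
  · exact Or.inl ⟨hab, h a b hab⟩
  · exact Or.inr ⟨hab, by simpa using h b a hab.le⟩

theorem hasPrimitive_psIntegral (s : ℝ) (h : ∀ t, PSIntegrable f v s t) :
    HasPrimitive f v (fun t => psIntegral f v s t) := by
  have h1 : ∀ t, s ≤ t → HasStieltjes f v s t (psIntegral f v s t) := by
    intro t ht
    rcases (h t).hasPSIntegral with ⟨_, h⟩ | ⟨h, _⟩
    · exact h
    · linarith
  have h0 : psIntegral f v s s = 0 := by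
    have := (h1 s le_rfl).trans le_rfl le_rfl (h1 s le_rfl)
    simpa using (h1 s le_rfl).unique le_rfl this
  have h2 : ∀ t, t ≤ s → HasStieltjes f v t s (-psIntegral f v s t) := by
    intro t ht
    rcases (h t).hasPSIntegral with ⟨h', h⟩ | ⟨_, h⟩
    · obtain rfl := le_antisymm ht h'
      simpa [h0] using h
    · exact h
  intro p q hpq
  rcases le_total s p with hp | hp
  · exact (h1 p hp).of_left hp (h1 q (hp.trans hpq))
  · rcases le_total s q with hq | hq
    · have := (h2 p hp).trans hp hq (h1 q hq)
      rwa [neg_add_eq_sub] at this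
    · have := (h2 q hq).of_right hq (h2 p hp)
      rwa [neg_sub_neg] at this

theorem HasPrimitive.map {Φ : ℝ → E} (L : E →L[ℝ] F) (h : HasPrimitive f v Φ) :
    HasPrimitive (fun t => L (f t)) v (fun t => L (Φ t)) := fun p q hpq => by
  simpa using (h p q hpq).map L

theorem HasPrimitive.sub {Φ Φ' : ℝ → E} (h : HasPrimitive f v Φ) (h' : HasPrimitive f' v Φ') :
    HasPrimitive (fun t => f t - f' t) v (fun t => Φ t - Φ' t) := fun p q hpq => by
  have := (h p q hpq).sub (h' p q hpq)
  rwa [sub_sub_sub_comm] at this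

/-- The Saks-Henstock lemma. -/
theorem HasPrimitive.saksHenstock {Φ : ℝ → E} (h : HasPrimitive f v Φ) (a b : ℝ)
    {ε : ℝ} (hε : 0 < ε) : ∃ δ : ℝ → ℝ, (∀ t, 0 < δ t) ∧ ∀ (n : ℕ) (s τ : ℕ → ℝ) (I : Finset ℕ),
      s 0 = a → s n = b → (∀ i < n, s i ≤ s (i + 1)) →
      (∀ i ∈ I, i < n ∧ IsFineCell δ (τ i) (s i) (s (i + 1))) →
      ‖∑ i ∈ I, ((v (s (i + 1)) - v (s i)) • f (τ i) - (Φ (s (i + 1)) - Φ (s i)))‖ ≤ ε := by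
  rcases lt_or_ge b a with hab | hab
  · refine ⟨fun _ => 1, fun _ => one_pos, fun n s τ I h0 hn hs _ => ?_⟩
    have : ∀ k ≤ n, s 0 ≤ s k := by
      intro k
      induction k with
      | zero => simp
      | succ k ih => intro hk; exact (ih (by omega)).trans (hs k (by omega))
    have := this n le_rfl
    linarith
  obtain ⟨δ, hδ, H⟩ := hasStieltjes_iff.1 (h a b hab) ε hε
  refine ⟨δ, hδ, fun n s τ I h0 hn hs hI => ?_⟩
  set e : ℕ → E := fun i => (v (s (i + 1)) - v (s i)) • f (τ i) - (Φ (s (i + 1)) - Φ (s i)) with he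
  -- Cells in `I` are kept. Every other cell is subdivided so finely that its sum is within `η` of
  -- the increment of `Φ`. The result is `δ`-fine, and its error is that of the cells in `I` up to
  -- `k * η`.
  have key : ∀ η > 0, ∀ k ≤ n, ∃ S, IsFineSum δ (stieltjesCell f v) (s 0) (s k) S ∧
      ‖S - (Φ (s k) - Φ (s 0)) - ∑ i ∈ Finset.range k, if i ∈ I then e i else 0‖ ≤ k * η := by
    intro η hη k
    induction k with
    | zero => intro _; exact ⟨0, .nil, by simp⟩
    | succ k ih =>
      intro hk
      obtain ⟨S, hS, hle⟩ := ih (by omega)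
      by_cases hkI : k ∈ I
      · refine ⟨_, hS.snoc (hI k hkI).2, ?_⟩
        rw [Finset.sum_range_succ, if_pos hkI]
        push_cast
        refine le_trans (le_of_eq ?_) (hle.trans (by nlinarith))
        congr 1
        simp only [he, stieltjesCell]
        abel
      · obtain ⟨δ', hδ', H'⟩ := hasStieltjes_iff.1 (h _ _ (hs k (by omega))) η hη
        obtain ⟨T, hT⟩ := exists_isFineSum (δ := fun t => min (δ t) (δ' t))
          (fun t => lt_min (hδ t) (hδ' t)) (stieltjesCell f v) (hs k (by omega))
        have h2 := H' T (hT.mono fun t => min_le_right _ _)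
        refine ⟨_, hS.trans (hT.mono fun t => min_le_left _ _), ?_⟩
        rw [Finset.sum_range_succ, if_neg hkI, add_zero]
        rw [show S + T - (Φ (s (k + 1)) - Φ (s 0)) - (∑ i ∈ Finset.range k, if i ∈ I then e i else 0)
          = (S - (Φ (s k) - Φ (s 0)) - ∑ i ∈ Finset.range k, if i ∈ I then e i else 0)
            + (T - (Φ (s (k + 1)) - Φ (s k))) by abel]
        refine (norm_add_le _ _).trans ?_
        push_cast
        linarith
  have hsum : (∑ i ∈ Finset.range n, if i ∈ I then e i else 0) = ∑ i ∈ I, e i := by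
    rw [← Finset.sum_filter]
    congr 1
    ext i
    simp only [Finset.mem_filter, Finset.mem_range]
    exact ⟨fun h => h.2, fun h => ⟨(hI i h).1, h⟩⟩
  refine le_of_forall_pos_le_add fun η hη => ?_
  obtain ⟨S, hS, hle⟩ := key (η / (n + 1)) (by positivity) n le_rfl
  rw [hsum] at hle
  rw [h0, hn] at hS hle
  have h1 := H S hS
  have h2 : (n : ℝ) * (η / (n + 1)) ≤ η := by
    rw [mul_div_assoc', div_le_iff₀ (by positivity)]
    nlinarith
  calc ‖∑ i ∈ I, e i‖ = ‖(S - (Φ b - Φ a)) - (S - (Φ b - Φ a) - ∑ i ∈ I, e i)‖ := by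
        congr 1; abel
    _ ≤ _ := norm_sub_le _ _
    _ ≤ _ := by linarith

/-- The Saks-Henstock lemma for the single cell `[s, s']` tagged at `t`. It yields both the left
continuity of primitives and their jump formula. -/
theorem HasPrimitive.local_estimate {Φ : ℝ → E} (h : HasPrimitive f v Φ) (t : ℝ) {ε : ℝ}
    (hε : 0 < ε) : ∃ δ > 0, ∀ s s', s ≤ t → t ≤ s' → t - δ < s → s' < t + δ →
      ‖(v s' - v s) • f t - (Φ s' - Φ s)‖ ≤ ε := by
  obtain ⟨δ, hδ, H⟩ := h.saksHenstock (t - 1) (t + 1) hε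
  refine ⟨min (δ t) 1, lt_min (hδ t) one_pos, fun s s' h1 h2 h3 h4 => ?_⟩
  have hm1 := min_le_left (δ t) 1
  have hm2 := min_le_right (δ t) 1
  have := H 3 (fun i => if i = 0 then t - 1 else if i = 1 then s else if i = 2 then s' else t + 1)
    (fun _ => t) {1} (by simp) (by simp)
    (by
      intro i hi
      interval_cases i
      · simp; linarith
      · simp; linarith
      · simp; linarith)
    (by simp; exact isFineCell_of_lt h1 h2 (by linarith) (by linarith))
  simpa using this

theorem HasPrimitive.continuousWithinAt_Iic {Φ : ℝ → E} (h : HasPrimitive f v Φ) {t : ℝ}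
    (hv : ContinuousWithinAt v (Iic t) t) : ContinuousWithinAt Φ (Iic t) t := by
  have h1 : Tendsto (fun s => (v t - v s) • f t - (Φ t - Φ s)) (𝓝[≤] t) (𝓝 0) := by
    rw [Metric.tendsto_nhdsWithin_nhds]
    intro ε hε
    obtain ⟨δ, hδ, H⟩ := h.local_estimate t (half_pos hε)
    refine ⟨δ, hδ, fun s hs hd => ?_⟩
    rw [dist_zero_right]
    rw [Real.dist_eq, abs_lt] at hd
    exact (H s t hs le_rfl (by linarith) (by linarith)).trans_lt (by linarith)
  have h2 : Tendsto (fun s => (v t - v s) • f t) (𝓝[≤] t) (𝓝 0) := by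
    simpa using (hv.tendsto.const_sub (v t)).smul_const (f t)
  have h3 := h1.sub h2
  have h4 := h3.add_const (Φ t)
  simp only [sub_self, zero_add] at h4
  refine h4.congr fun s => ?_
  abel

theorem HasPrimitive.tendsto_nhdsGT {Φ : ℝ → E} (h : HasPrimitive f v Φ) {t d : ℝ}
    (hv : Tendsto v (𝓝[>] t) (𝓝 (v t + d))) :
    Tendsto Φ (𝓝[>] t) (𝓝 (Φ t + d • f t)) := by
  have h1 : Tendsto (fun s => (v s - v t) • f t - (Φ s - Φ t)) (𝓝[>] t) (𝓝 0) := by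
    rw [Metric.tendsto_nhdsWithin_nhds]
    intro ε hε
    obtain ⟨δ, hδ, H⟩ := h.local_estimate t (half_pos hε)
    refine ⟨δ, hδ, fun s hs hd => ?_⟩
    rw [dist_zero_right]
    rw [Real.dist_eq, abs_lt] at hd
    exact (H t s le_rfl (le_of_lt hs) (by linarith) (by linarith)).trans_lt (by linarith)
  have h2 : Tendsto (fun s => (v s - v t) • f t) (𝓝[>] t) (𝓝 (d • f t)) := by
    have := (hv.sub_const (v t)).smul_const (f t)
    simpa using this
  have h4 := (h2.sub h1).const_add (Φ t)
  simp only [sub_zero] at h4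
  refine h4.congr fun s => ?_
  abel

end Stieltjes

/-! ### Measurability from one-sided limits -/

section Measurability

variable {E : Type*} [TopologicalSpace E]

/-- Samples `h` on a grid. With `a = n + 1` and `c = 1/(n + 1)`, the sampled point tends to `r` as
`n → ∞`: strictly from the right for `b = 1`, and from the left, `r` included, for `b = 0`. -/
theorem stronglyMeasurable_comp_floor (h : ℝ → E) (a b c : ℝ) :
    StronglyMeasurable fun r : ℝ => h (((⌊r * a⌋ : ℤ) + b) * c) := by
  have h1 : StronglyMeasurable fun k : ℤ => h (((k : ℝ) + b) * c) := .of_discrete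
  exact h1.comp_measurable (Int.measurable_floor.comp (measurable_id.mul_const a))

variable [TopologicalSpace.PseudoMetrizableSpace E]

/-- The function of right limits is strongly measurable. -/
theorem stronglyMeasurable_of_tendsto_nhdsGT {h w : ℝ → E}
    (H : ∀ r, Tendsto h (𝓝[>] r) (𝓝 (w r))) : StronglyMeasurable w := by
  refine stronglyMeasurable_of_tendsto atTop
    (fun n : ℕ => stronglyMeasurable_comp_floor h (n + 1) 1 ((n : ℝ) + 1)⁻¹) ?_
  rw [tendsto_pi_nhds]
  intro r
  refine (H r).comp (tendsto_nhdsWithin_iff.2 ⟨?_, Eventually.of_forall fun n => ?_⟩)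
  · refine tendsto_of_tendsto_of_tendsto_of_le_of_le (g := fun _ => r)
      (h := fun n : ℕ => r + 1 / ((n : ℝ) + 1)) tendsto_const_nhds ?_ ?_ ?_
    · simpa using tendsto_one_div_add_atTop_nhds_zero_nat.const_add r
    · intro n
      have hn : (0 : ℝ) < n + 1 := by positivity
      simp only [← div_eq_mul_inv]
      rw [le_div_iff₀ hn]
      exact (Int.lt_floor_add_one _).le
    · intro n
      have hn : (0 : ℝ) < n + 1 := by positivity
      simp only [← div_eq_mul_inv]
      rw [div_le_iff₀ hn, add_mul, one_div, inv_mul_cancel₀ hn.ne']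
      linarith [Int.floor_le (r * ((n : ℝ) + 1))]
  · have hn : (0 : ℝ) < n + 1 := by positivity
    simp only [← div_eq_mul_inv, mem_Ioi]
    rw [lt_div_iff₀ hn]
    exact Int.lt_floor_add_one _

theorem stronglyMeasurable_of_continuousWithinAt_Iic {h : ℝ → E}
    (H : ∀ r, ContinuousWithinAt h (Iic r) r) : StronglyMeasurable h := by
  refine stronglyMeasurable_of_tendsto atTop
    (fun n : ℕ => stronglyMeasurable_comp_floor h (n + 1) 0 ((n : ℝ) + 1)⁻¹) ?_
  rw [tendsto_pi_nhds]
  intro r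
  refine (H r).tendsto.comp (tendsto_nhdsWithin_iff.2 ⟨?_, Eventually.of_forall fun n => ?_⟩)
  · refine tendsto_of_tendsto_of_tendsto_of_le_of_le (g := fun n : ℕ => r - 1 / ((n : ℝ) + 1))
      (h := fun _ => r) ?_ tendsto_const_nhds ?_ ?_
    · simpa using tendsto_one_div_add_atTop_nhds_zero_nat.const_sub r
    · intro n
      have hn : (0 : ℝ) < n + 1 := by positivity
      simp only [← div_eq_mul_inv]
      rw [le_div_iff₀ hn, sub_mul, one_div, inv_mul_cancel₀ hn.ne']
      linarith [Int.lt_floor_add_one (r * ((n : ℝ) + 1))]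
    · intro n
      have hn : (0 : ℝ) < n + 1 := by positivity
      simp only [← div_eq_mul_inv]
      rw [div_le_iff₀ hn]
      linarith [Int.floor_le (r * ((n : ℝ) + 1))]
  · have hn : (0 : ℝ) < n + 1 := by positivity
    simp only [← div_eq_mul_inv, mem_Iic]
    rw [div_le_iff₀ hn]
    linarith [Int.floor_le (r * ((n : ℝ) + 1))]

end Measurability

/-! ### Stieltjes measures and domination of Perron integrals -/

theorem setIntegral_Ico_add {E : Type*} [NormedAddCommGroup E] [NormedSpace ℝ E] {μ : Measure ℝ}
    {f : ℝ → E} {a b c : ℝ} (hab : a ≤ b) (hbc : b ≤ c) (h : IntegrableOn f (Ico a c) μ) :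
    ∫ s in Ico a b, f s ∂μ + ∫ s in Ico b c, f s ∂μ = ∫ s in Ico a c, f s ∂μ := by
  rw [← Ico_union_Ico_eq_Ico hab hbc, setIntegral_union (Ico_disjoint_Ico_same) measurableSet_Ico
    (h.mono_set (Ico_subset_Ico_right hbc)) (h.mono_set (Ico_subset_Ico_left hab))]

theorem le_of_succ_le {s : ℕ → ℝ} {n : ℕ} (hs : ∀ i < n, s i ≤ s (i + 1)) :
    ∀ k ≤ n, s 0 ≤ s k := by
  intro k
  induction k with
  | zero => simp
  | succ k ih => intro hk; exact (ih (by omega)).trans (hs k (by omega))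

theorem sum_setIntegral_Ico {E : Type*} [NormedAddCommGroup E] [NormedSpace ℝ E] {μ : Measure ℝ}
    {f : ℝ → E} {s : ℕ → ℝ} {n : ℕ} (hs : ∀ i < n, s i ≤ s (i + 1))
    (h : IntegrableOn f (Ico (s 0) (s n)) μ) :
    ∑ i ∈ Finset.range n, ∫ t in Ico (s i) (s (i + 1)), f t ∂μ = ∫ t in Ico (s 0) (s n), f t ∂μ := by
  induction n with
  | zero => simp
  | succ n ih =>
    rw [Finset.sum_range_succ, ih (fun i hi => hs i (by omega))
      (h.mono_set (Ico_subset_Ico_right (hs n (by omega))))]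
    exact setIntegral_Ico_add (le_of_succ_le hs n (by omega)) (hs n (by omega)) h

/-- `μ` is the Lebesgue-Stieltjes measure of the nondecreasing left-continuous function `v`. -/
structure IsStieltjesMeasure (v : ℝ → ℝ) (μ : Measure ℝ) : Prop where
  mono : Monotone v
  left_continuous : ∀ t, ContinuousWithinAt v (Iic t) t
  measure_Ico : ∀ a b, μ (Ico a b) = ENNReal.ofReal (v b - v a)

theorem isStieltjesMeasure_id : IsStieltjesMeasure id volume where
  mono := monotone_id
  left_continuous _ := continuousWithinAt_id
  measure_Ico := by simp

theorem isStieltjesMeasure_duMeasure {u : ℝ → ℝ} (hu : Monotone u)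
    (hc : ∀ t, ContinuousWithinAt u (Iic t) t) : IsStieltjesMeasure u (duMeasure u hu) where
  mono := hu
  left_continuous := hc
  measure_Ico a b := by
    have h : ∀ t, Function.leftLim hu.stieltjesFunction t = u t := by
      intro t
      refine le_antisymm ?_ ?_
      · rw [Monotone.leftLim_eq_sSup hu.stieltjesFunction.mono]
        refine csSup_le (by simp) ?_
        rintro _ ⟨s, hs, rfl⟩
        exact hu.rightLim_le hs
      · refine le_of_tendsto ((hc t).tendsto.mono_left (nhdsWithin_mono t Iio_subset_Iic_self)) ?_
        filter_upwards [self_mem_nhdsWithin] with s hs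
        exact (hu.le_rightLim le_rfl).trans (hu.stieltjesFunction.mono.le_leftLim hs)
    rw [duMeasure, StieltjesFunction.measure_Ico, h, h]

namespace IsStieltjesMeasure

variable {v : ℝ → ℝ} {μ : Measure ℝ}

theorem real_Ico (hv : IsStieltjesMeasure v μ) {a b : ℝ} (hab : a ≤ b) :
    μ.real (Ico a b) = v b - v a := by
  rw [measureReal_def, hv.measure_Ico, ENNReal.toReal_ofReal (sub_nonneg.2 (hv.mono hab))]

theorem integrableOn_Icc_of_Ico {f : ℝ → ℝ}
    (h : ∀ c d, c ≤ d → IntegrableOn f (Ico c d) μ) (a b : ℝ) : IntegrableOn f (Icc a b) μ := by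
  rcases le_or_gt a b with hab | hab
  · exact (h a (b + 1) (by linarith)).mono_set fun x hx => ⟨hx.1, hx.2.trans_lt (by linarith)⟩
  · simp [hab.not_ge]

variable [IsLocallyFiniteMeasure μ]

/-- Vitali-Carathéodory: a lower semicontinuous majorant with almost the same integral stays above
`q τ` near `τ`. On cells fine for the resulting gauge, tagged sums of `q` are bounded by integrals
of the majorant. -/
theorem exists_upper_gauge (hv : IsStieltjesMeasure v μ) {q : ℝ → ℝ} (hq : Integrable q μ) {ε : ℝ}
    (hε : 0 < ε) : ∃ G : ℝ → ℝ, Integrable G μ ∧ (∀ᵐ t ∂μ, q t ≤ G t) ∧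
      ∫ t, G t ∂μ ≤ ∫ t, q t ∂μ + ε ∧ ∃ δ : ℝ → ℝ, (∀ t, 0 < δ t) ∧
        ∀ τ s s', IsFineCell δ τ s s' → (v s' - v s) * q τ ≤ ∫ t in Ico s s', G t ∂μ := by
  obtain ⟨g, hqg, hlsc, hint, hlt, hle⟩ := exists_lt_lowerSemicontinuous_integral_lt q hq hε
  have hqG : ∀ᵐ t ∂μ, q t ≤ (g t).toReal := by
    filter_upwards [hlt] with t ht
    exact EReal.coe_le_coe_iff.1 ((hqg t).le.trans (EReal.le_coe_toReal ht.ne))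
  refine ⟨_, hint, hqG, hle.le, ?_⟩
  have : ∀ τ, ∃ d > 0, ∀ t, |t - τ| < d → (q τ : EReal) < g t := fun τ => by
    obtain ⟨d, hd, h⟩ := Metric.eventually_nhds_iff.1 (hlsc τ _ (hqg τ))
    exact ⟨d, hd, fun t ht => h ht⟩
  choose δ hδ H using this
  refine ⟨δ, hδ, fun τ s s' hc => ?_⟩
  have hfin : μ (Ico s s') ≠ ⊤ := by rw [hv.measure_Ico]; exact ENNReal.ofReal_ne_top
  calc (v s' - v s) * q τ = ∫ t in Ico s s', q τ ∂μ := by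
        rw [setIntegral_const, hv.real_Ico hc.le, smul_eq_mul]
    _ ≤ _ := by
        refine setIntegral_mono_on_ae (integrableOn_const hfin) hint.integrableOn
          measurableSet_Ico ?_
        filter_upwards [hlt] with t ht hts
        have h1 := hc.2.2 ⟨hts.1, hts.2.le⟩
        have h2 := H τ t (abs_lt.2 ⟨by linarith [h1.1], by linarith [h1.2]⟩)
        exact EReal.coe_le_coe_iff.1 (h2.le.trans (EReal.le_coe_toReal ht.ne))

/-- A scalar function is dominated almost everywhere by any function whose integral dominates
its indefinite Perron-Stieltjes integral. -/
theorem ae_abs_le (hv : IsStieltjesMeasure v μ) {g Φ m : ℝ → ℝ} (hg : HasPrimitive g v Φ)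
    (hm : ∀ c d, c ≤ d → IntegrableOn m (Ico c d) μ)
    (hle : ∀ c d, c ≤ d → |Φ d - Φ c| ≤ ∫ s in Ico c d, m s ∂μ) : ∀ᵐ s ∂μ, |g s| ≤ m s := by
  have key : ∀ (a b η : ℝ), a < b → 0 < η → μ {s ∈ Ico a b | m s + η < |g s|} = 0 := by
    intro a b η hab hη
    set Z := {s ∈ Ico a b | m s + η < |g s|} with hZ
    -- `Z` is covered up to an exhaustion by cells of total mass at most `3 * ε / η`: `2 * ε` comes
    -- from Saks-Henstock, and `ε` from a majorant of `-m`, which bounds `m` at the tags from below.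
    have hbound : ∀ ε > 0, μ Z ≤ ENNReal.ofReal (3 * ε / η) := by
      intro ε hε
      obtain ⟨δ₁, hδ₁, H₁⟩ := hg.saksHenstock a b hε
      have hmi : Integrable (indicator (Icc a b) (fun t => - m t)) μ :=
        (integrable_indicator_iff measurableSet_Icc).2 (integrableOn_Icc_of_Ico hm a b).neg
      obtain ⟨G, hG, hqG, hGle, δ₂, hδ₂, H₂⟩ := hv.exists_upper_gauge hmi hε
      set δ : ℝ → ℝ := fun t => min (δ₁ t) (δ₂ t) with hδ
      have hδ0 : ∀ t, 0 < δ t := fun t => lt_min (hδ₁ t) (hδ₂ t)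
      -- On `Zk k` the gauge exceeds `1/(k+1)`, so the cells of a uniform grid of smaller mesh are
      -- fine for any tag in `Zk k`. Continuity from below along `Zk` needs no measurability of
      -- these sets.
      set Zk : ℕ → Set ℝ := fun k => {s ∈ Z | 1 / ((k : ℝ) + 1) < δ s} with hZk
      have hmono : Monotone Zk := by
        intro k l hkl s hs
        refine ⟨hs.1, lt_of_le_of_lt ?_ hs.2⟩
        exact Nat.one_div_le_one_div hkl
      have hU : Z = ⋃ k, Zk k := by
        ext s
        simp only [mem_iUnion]
        constructor
        · intro hs
          obtain ⟨k, hk⟩ := exists_nat_one_div_lt (hδ0 s)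
          exact ⟨k, hs, hk⟩
        · rintro ⟨k, hk⟩
          exact hk.1
      rw [hU, hmono.measure_iUnion]
      refine iSup_le fun k => ?_
      obtain ⟨N, hN⟩ := exists_nat_gt ((b - a) * (k + 1))
      have hk0 : (0 : ℝ) < k + 1 := by positivity
      have hN0 : (0 : ℝ) < N := lt_trans (by have := sub_pos.2 hab; positivity) hN
      set w : ℝ := (b - a) / N with hw
      have hw0 : 0 < w := div_pos (sub_pos.2 hab) hN0
      have hwN : w * N = b - a := div_mul_cancel₀ _ hN0.ne'
      have hwk : w < 1 / ((k : ℝ) + 1) := by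
        rw [hw, div_lt_div_iff₀ hN0 hk0]; linarith
      set s : ℕ → ℝ := fun i => a + i * w with hs
      have hs0 : s 0 = a := by simp [hs]
      have hsN : s N = b := by simp only [hs]; linarith
      have hsucc : ∀ i, s (i + 1) = s i + w := fun i => by simp only [hs]; push_cast; ring
      have hsle : ∀ i < N, s i ≤ s (i + 1) := fun i _ => by linarith [hsucc i]
      classical
      set I : Finset ℕ := (Finset.range N).filter
        fun i => (Zk k ∩ Ico (s i) (s (i + 1))).Nonempty with hI
      have hex : ∀ i, ∃ τ, i ∈ I → τ ∈ Zk k ∩ Ico (s i) (s (i + 1)) := by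
        intro i
        by_cases hi : i ∈ I
        · obtain ⟨τ, hτ⟩ := (Finset.mem_filter.1 hi).2
          exact ⟨τ, fun _ => hτ⟩
        · exact ⟨0, fun h => absurd h hi⟩
      choose τ hτ using hex
      have hcell : ∀ i ∈ I, i < N ∧ IsFineCell δ (τ i) (s i) (s (i + 1)) := by
        intro i hi
        obtain ⟨⟨_, h1⟩, h2, h3⟩ := hτ i hi
        refine ⟨Finset.mem_range.1 (Finset.mem_filter.1 hi).1, isFineCell_of_lt h2 h3.le ?_ ?_⟩ <;>
          linarith [hsucc i]
      have hcover : Zk k ⊆ ⋃ i ∈ I, Ico (s i) (s (i + 1)) := by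
        intro t ht
        have hta := ht.1.1
        have hpos : 0 ≤ (t - a) / w := div_nonneg (sub_nonneg.2 hta.1) hw0.le
        set i := ⌊(t - a) / w⌋₊ with hi
        have h1 : (i : ℝ) * w ≤ t - a := (le_div_iff₀ hw0).1 (Nat.floor_le hpos)
        have h2 : t - a < (i + 1) * w := (div_lt_iff₀ hw0).1 (Nat.lt_floor_add_one _)
        have hti : t ∈ Ico (s i) (s (i + 1)) := by
          simp only [hs]
          push_cast
          exact ⟨by linarith, by linarith⟩
        have hiN : i < N := by
          have : (i : ℝ) * w < N * w := by linarith [hta.2]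
          exact_mod_cast lt_of_mul_lt_mul_right this hw0.le
        simp only [mem_iUnion]
        exact ⟨i, Finset.mem_filter.2 ⟨Finset.mem_range.2 hiN, t, ht, hti⟩, hti⟩
      set e : ℕ → ℝ := fun i => (v (s (i + 1)) - v (s i)) • g (τ i) - (Φ (s (i + 1)) - Φ (s i))
        with he
      have hsub : ∀ I' ⊆ I, |∑ i ∈ I', e i| ≤ ε := fun I' hI' =>
        H₁ N s τ I' hs0 hsN hsle fun i hi => ⟨(hcell i (hI' hi)).1,
          (hcell i (hI' hi)).2.mono fun t => min_le_left _ _⟩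
      -- Saks-Henstock bounds sums of signed errors. Applied separately to the nonnegative and the
      -- negative ones, it bounds the sum of absolute values.
      have habs : ∑ i ∈ I, |e i| ≤ 2 * ε := by
        rw [← Finset.sum_filter_add_sum_filter_not I (fun i => 0 ≤ e i)]
        have h1 := hsub (I.filter fun i => 0 ≤ e i) (Finset.filter_subset _ _)
        have h2 := hsub (I.filter fun i => ¬ 0 ≤ e i) (Finset.filter_subset _ _)
        have h3 : ∑ i ∈ I with 0 ≤ e i, |e i| = ∑ i ∈ I with 0 ≤ e i, e i :=
          Finset.sum_congr rfl fun i hi => abs_of_nonneg (Finset.mem_filter.1 hi).2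
        have h4 : ∑ i ∈ I with ¬ 0 ≤ e i, |e i| = - ∑ i ∈ I with ¬ 0 ≤ e i, e i := by
          rw [← Finset.sum_neg_distrib]
          exact Finset.sum_congr rfl fun i hi =>
            abs_of_nonpos (not_le.1 (Finset.mem_filter.1 hi).2).le
        rw [h3, h4]
        linarith [abs_le.1 h1, abs_le.1 h2]
      have hcellIcc : ∀ i < N, Ico (s i) (s (i + 1)) ⊆ Icc a b := by
        intro i hi t ht
        have h1 : a ≤ s i := by simp only [hs]; nlinarith [(Nat.cast_nonneg i : (0 : ℝ) ≤ i)]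
        have h2 : s (i + 1) ≤ b := by
          have : ((i + 1 : ℕ) : ℝ) ≤ N := by exact_mod_cast hi
          simp only [hs]
          nlinarith
        exact ⟨h1.trans ht.1, ht.2.le.trans h2⟩
      set R : ℝ → ℝ := fun t => G t - indicator (Icc a b) (fun t => - m t) t with hR
      have hRi : Integrable R μ := hG.sub hmi
      have hR0 : 0 ≤ᵐ[μ] R := by filter_upwards [hqG] with t ht using sub_nonneg.2 ht
      have hRle : ∫ t, R t ∂μ ≤ ε := by
        rw [integral_sub hG hmi]; linarith
      have hRsum : ∑ i ∈ I, ∫ t in Ico (s i) (s (i + 1)), R t ∂μ ≤ ε := by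
        calc _ ≤ ∑ i ∈ Finset.range N, ∫ t in Ico (s i) (s (i + 1)), R t ∂μ :=
              Finset.sum_le_sum_of_subset_of_nonneg (Finset.filter_subset _ _)
                fun i _ _ => integral_nonneg_of_ae (ae_restrict_of_ae hR0)
          _ = ∫ t in Ico (s 0) (s N), R t ∂μ := sum_setIntegral_Ico hsle hRi.integrableOn
          _ ≤ ∫ t, R t ∂μ := setIntegral_le_integral hRi hR0
          _ ≤ ε := hRle
      -- At a tag `|g| > m + η`, hence `η Δv ≤ Δv |g τ| - Δv m τ ≤ |e i| + |ΔΦ| + ∫ G`, and `|ΔΦ| ≤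
      -- ∫ m` while `R = G + m` on the cell.
      have hterm : ∀ i ∈ I, η * (v (s (i + 1)) - v (s i)) ≤
          |e i| + ∫ t in Ico (s i) (s (i + 1)), R t ∂μ := by
        intro i hi
        obtain ⟨hiN, hc⟩ := hcell i hi
        have h1 := H₂ _ _ _ (hc.mono fun t => min_le_right _ _)
        have hτi : τ i ∈ Icc a b := hcellIcc i hiN (hτ i hi).2
        rw [indicator_of_mem hτi] at h1
        have hd : 0 ≤ v (s (i + 1)) - v (s i) := sub_nonneg.2 (hv.mono (hsle i hiN))
        have h2 : ∫ t in Ico (s i) (s (i + 1)), R t ∂μ = ∫ t in Ico (s i) (s (i + 1)), G t ∂μ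
            + ∫ t in Ico (s i) (s (i + 1)), m t ∂μ := by
          rw [hR, integral_sub hG.integrableOn hmi.integrableOn]
          rw [setIntegral_congr_fun (f := indicator _ _) (g := fun t => - m t) measurableSet_Ico
            fun t ht => indicator_of_mem (hcellIcc i hiN ht) _, integral_neg, sub_neg_eq_add]
        have h3 := hle _ _ (hsle i hiN)
        have h4 := (hτ i hi).1.1.2
        have h5 : (v (s (i + 1)) - v (s i)) * |g (τ i)| ≤ |e i| + |Φ (s (i + 1)) - Φ (s i)| := by
          calc _ = |e i + (Φ (s (i + 1)) - Φ (s i))| := by simp [he, abs_mul, abs_of_nonneg hd]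
            _ ≤ _ := abs_add_le _ _
        nlinarith
      have hfinal : η * ∑ i ∈ I, (v (s (i + 1)) - v (s i)) ≤ 3 * ε := by
        rw [Finset.mul_sum]
        refine (Finset.sum_le_sum hterm).trans ?_
        rw [Finset.sum_add_distrib]
        linarith
      calc μ (Zk k) ≤ μ (⋃ i ∈ I, Ico (s i) (s (i + 1))) := measure_mono hcover
        _ ≤ ∑ i ∈ I, μ (Ico (s i) (s (i + 1))) := measure_biUnion_finset_le _ _
        _ = ENNReal.ofReal (∑ i ∈ I, (v (s (i + 1)) - v (s i))) := by
            rw [ENNReal.ofReal_sum_of_nonneg fun i hi =>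
              sub_nonneg.2 (hv.mono (hsle i (hcell i hi).1))]
            exact Finset.sum_congr rfl fun i _ => hv.measure_Ico _ _
        _ ≤ _ := ENNReal.ofReal_le_ofReal (by rw [le_div_iff₀ hη]; linarith)
    refine le_antisymm (ge_of_tendsto (x := 𝓝[>] (0 : ℝ))
      (f := fun ε => ENNReal.ofReal (3 * ε / η)) ?_ ?_) bot_le
    · have : Tendsto (fun ε : ℝ => 3 * ε / η) (𝓝[>] 0) (𝓝 (3 * 0 / η)) :=
        (((continuous_const.mul continuous_id).div_const η).tendsto 0).mono_left nhdsWithin_le_nhds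
      simpa using ENNReal.tendsto_ofReal this
    · filter_upwards [self_mem_nhdsWithin] with ε hε using hbound ε hε
  rw [ae_iff]
  refine measure_mono_null (t := ⋃ n : ℕ, ⋃ k : ℕ,
    {s ∈ Ico (-((n : ℝ) + 1)) (n + 1) | m s + 1 / ((k : ℝ) + 1) < |g s|}) ?_ ?_
  · intro s hs
    simp only [mem_ofPred_eq, not_le] at hs
    obtain ⟨n, hn⟩ := exists_nat_gt |s|
    obtain ⟨k, hk⟩ := exists_nat_one_div_lt (sub_pos.2 hs)
    simp only [mem_iUnion]
    have := abs_lt.1 hn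
    exact ⟨n, k, ⟨by linarith, by linarith⟩, by linarith⟩
  · refine measure_iUnion_null fun n => measure_iUnion_null fun k => key _ _ _ ?_ ?_
    · have : (0 : ℝ) ≤ n := Nat.cast_nonneg n
      linarith
    · positivity

theorem abs_hasStieltjes_le (hv : IsStieltjesMeasure v μ) {k q : ℝ → ℝ} {a b J : ℝ} (hab : a ≤ b)
    (hJ : HasStieltjes k v a b J) (hq : IntegrableOn q (Icc a b) μ)
    (hkq : ∀ᵐ s ∂μ, s ∈ Icc a b → |k s| ≤ q s) : |J| ≤ ∫ s in Ico a b, q s ∂μ := by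
  -- Tagged sums see every point, including null sets, so `q` is raised to dominate `|k|` everywhere
  -- on `[a, b]`. This changes it only on a null set.
  set q' : ℝ → ℝ := indicator (Icc a b) fun s => max (q s) |k s| with hq'
  have hae : q' =ᵐ[μ] indicator (Icc a b) q := by
    filter_upwards [hkq] with s hs
    by_cases h : s ∈ Icc a b
    · simp only [hq', indicator_of_mem h]
      exact max_eq_left (hs h)
    · simp only [hq', indicator_of_notMem h]
  have hqi : Integrable q' μ :=
    ((integrable_indicator_iff measurableSet_Icc).2 hq).congr hae.symm
  have hqq : ∫ s in Ico a b, q' s ∂μ = ∫ s in Ico a b, q s ∂μ := by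
    refine setIntegral_congr_ae measurableSet_Ico ?_
    filter_upwards [hae] with s hs hsI
    rw [hs, indicator_of_mem (Ico_subset_Icc_self hsI)]
  refine le_of_forall_pos_le_add fun ε hε => ?_
  obtain ⟨G, hG, hqG, hGle, δ, hδ, H⟩ := hv.exists_upper_gauge hqi (half_pos hε)
  obtain ⟨δ', hδ', H'⟩ := hasStieltjes_iff.1 hJ (ε / 2) (half_pos hε)
  obtain ⟨S, hS⟩ := exists_isFineSum (δ := fun t => min (δ t) (δ' t))
    (fun t => lt_min (hδ t) (hδ' t)) (stieltjesCell k v) hab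
  have h1 := H' S (hS.mono fun t => min_le_right _ _)
  have h2 : ∀ c T, IsFineSum δ (stieltjesCell k v) a c T → c ≤ b →
      |T| ≤ ∫ s in Ico a c, G s ∂μ := by
    intro c T hT
    induction hT with
    | nil => simp
    | @snoc p c τ T hT hc ih =>
      intro hcb
      rw [← setIntegral_Ico_add hT.le hc.le hG.integrableOn]
      refine (abs_add_le _ _).trans (add_le_add (ih (hc.le.trans hcb)) (le_trans ?_ (H _ _ _ hc)))
      have hd : 0 ≤ v c - v p := sub_nonneg.2 (hv.mono hc.le)
      have hτ : τ ∈ Icc a b := ⟨hT.le.trans hc.1, hc.2.1.trans hcb⟩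
      simp only [stieltjesCell, smul_eq_mul, abs_mul, abs_of_nonneg hd, hq', indicator_of_mem hτ]
      exact mul_le_mul_of_nonneg_left (le_max_right _ _) hd
  have h3 := h2 b S (hS.mono fun t => min_le_left _ _) le_rfl
  have h4 : ∫ s in Ico a b, (G s - q' s) ∂μ ≤ ∫ s, (G s - q' s) ∂μ :=
    setIntegral_le_integral (hG.sub hqi)
      (by filter_upwards [hqG] with t ht using sub_nonneg.2 ht)
  rw [integral_sub hG hqi, integral_sub hG.integrableOn hqi.integrableOn] at h4
  have h5 : |J| ≤ |S| + |S - J| := by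
    have := abs_sub_abs_le_abs_sub J S
    rw [abs_sub_comm] at this
    linarith
  rw [Real.norm_eq_abs] at h1
  linarith

/-- Bound of `∫ B y dv` by the supremum of `y` and a majorant of the integral of `B`. -/
theorem norm_hasStieltjes_clm_le (hv : IsStieltjesMeasure v μ) {Y F : Type*}
    [NormedAddCommGroup Y] [NormedSpace ℝ Y] [NormedAddCommGroup F] [NormedSpace ℝ F]
    {B Φ : ℝ → Y →L[ℝ] F} {m : ℝ → ℝ} (hB : HasPrimitive B v Φ) (hm0 : ∀ s, 0 ≤ m s)
    (hm : ∀ c d, c ≤ d → IntegrableOn m (Ico c d) μ)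
    (hle : ∀ c d, c ≤ d → ‖Φ d - Φ c‖ ≤ ∫ s in Ico c d, m s ∂μ) {y : ℝ → Y}
    (hy : ∀ t, ContinuousWithinAt y (Iic t) t) {a b M : ℝ} {J : F} (hab : a ≤ b)
    (hJ : HasStieltjes (fun s => B s (y s)) v a b J) (hM : ∀ s ∈ Icc a b, ‖y s‖ ≤ M) :
    ‖J‖ ≤ M * ∫ s in Ico a b, m s ∂μ := by
  obtain ⟨x, hx1, hxJ⟩ := exists_dual_vector'' ℝ J
  have h1 : ∀ z : Y, ∀ᵐ s ∂μ, |x (B s z)| ≤ m s * ‖z‖ := by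
    intro z
    refine hv.ae_abs_le (Φ := fun t => x (Φ t z))
      (hB.map (x.comp (ContinuousLinearMap.apply ℝ F z)))
      (fun c d hcd => (hm c d hcd).mul_const _) fun c d hcd => ?_
    rw [← map_sub, ← sub_apply, integral_mul_const]
    calc |x ((Φ d - Φ c) z)| ≤ ‖x‖ * ‖(Φ d - Φ c) z‖ := x.le_opNorm _
      _ ≤ 1 * (‖Φ d - Φ c‖ * ‖z‖) := by gcongr; exact (Φ d - Φ c).le_opNorm z
      _ ≤ _ := by rw [one_mul]; gcongr; exact hle c d hcd
  -- The exceptional null set in `h1` depends on the vector. Using only the countably many `y r`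
  -- with `r` rational gives a common one, and left continuity of `y` then reaches `y s` through
  -- rationals `r < s`.
  have h2 : ∀ᵐ s ∂μ, ∀ r : ℚ, |x (B s (y r))| ≤ m s * ‖y r‖ := ae_all_iff.2 fun r => h1 _
  have h3 : ∀ᵐ s ∂μ, |x (B s (y s))| ≤ m s * ‖y s‖ := by
    filter_upwards [h2] with s hs
    have hcl : IsClosed {z | |x (B s z)| ≤ m s * ‖z‖} :=
      isClosed_le (by fun_prop) (by fun_prop)
    set R : Set ℝ := Iio s ∩ range ((↑) : ℚ → ℝ) with hR
    have hsR : s ∈ closure R := by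
      have h4 := (Rat.denseRange_cast (𝕜 := ℝ)).open_subset_closure_inter (isOpen_Iio (a := s))
      have h5 := closure_minimal h4 isClosed_closure
      rw [closure_Iio] at h5
      exact h5 (mem_Iic.2 le_rfl)
    have h6 := ((hy s).mono (fun t ht => (le_of_lt ht.1 : t ≤ s)) :
      ContinuousWithinAt y R s).mem_closure_image hsR
    refine closure_minimal ?_ hcl h6
    rintro _ ⟨_, ⟨_, r, rfl⟩, rfl⟩
    exact hs r
  have h4 := hv.abs_hasStieltjes_le (q := fun s => M * m s) hab (hJ.map x)
    ((integrableOn_Icc_of_Ico hm a b).const_mul M) (by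
      filter_upwards [h3] with s hs hsI
      refine hs.trans ?_
      rw [mul_comm]
      exact mul_le_mul_of_nonneg_right (hM s hsI) (hm0 s))
  rw [integral_const_mul] at h4
  rw [hxJ] at h4
  simpa using h4

end IsStieltjesMeasure

/-! ### Integration by parts for operator-valued integrands -/

section Product

variable {Y F : Type*} [NormedAddCommGroup Y] [NormedSpace ℝ Y] [NormedAddCommGroup F]
  [NormedSpace ℝ F] {v : ℝ → ℝ} {B Φ Φ' : ℝ → Y →L[ℝ] F}

theorem sum_clm_apply_by_parts (e : ℕ → Y →L[ℝ] F) (ζ : ℕ → Y) (n : ℕ) :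
    ∑ i ∈ Finset.range n, e i (ζ i) = (∑ i ∈ Finset.range n, e i) (ζ n)
      - ∑ i ∈ Finset.range n, (∑ j ∈ Finset.range (i + 1), e j) (ζ (i + 1) - ζ i) := by
  induction n with
  | zero => simp
  | succ n ih =>
    rw [Finset.sum_range_succ (fun i => e i (ζ i)), ih, Finset.sum_range_succ (fun i =>
      (∑ j ∈ Finset.range (i + 1), e j) (ζ (i + 1) - ζ i)), map_sub, Finset.sum_range_succ e n]
    simp only [add_apply]
    abel

/-- Allows `B (τ) Δv` to be replaced by `ΔΦ` in sums applied to `ξ`. Saks-Henstock makes norms of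
partial sums of the operator errors small, not sums of their norms. Abel summation transfers the
differences to `ξ`, whose variation `ρ` controls. -/
theorem HasPrimitive.exists_gauge_clm_apply (hB : HasPrimitive B v Φ) {a b : ℝ} (hab : a ≤ b)
    {ξ : ℝ → Y} {ρ : ℝ → ℝ} (hρ : ∀ p q, a ≤ p → p ≤ q → q ≤ b → ‖ξ q - ξ p‖ ≤ ρ q - ρ p)
    {ε : ℝ} (hε : 0 < ε) : ∃ δ : ℝ → ℝ, (∀ t, 0 < δ t) ∧ ∀ (n : ℕ) (s τ : ℕ → ℝ),
      IsFineDivision δ a b n s τ → ‖∑ i ∈ Finset.range n,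
        ((v (s (i + 1)) - v (s i)) • B (τ i) (ξ (τ i)) - (Φ (s (i + 1)) - Φ (s i)) (ξ (τ i)))‖
          ≤ ε := by
  have hmono : ∀ p q, a ≤ p → p ≤ q → q ≤ b → ρ p ≤ ρ q := fun p q h1 h2 h3 => by
    linarith [norm_nonneg (ξ q - ξ p), hρ p q h1 h2 h3]
  set c := ‖ξ b‖ + (ρ b - ρ a) + 1 with hc
  have hc0 : 0 < c := by
    have := norm_nonneg (ξ b)
    have := hmono a b le_rfl hab le_rfl
    linarith
  obtain ⟨δ, hδ, H⟩ := hB.saksHenstock a b (div_pos hε hc0)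
  refine ⟨δ, hδ, fun n s τ ⟨h0, hn, hf⟩ => ?_⟩
  have hs : ∀ i < n, s i ≤ s (i + 1) := fun i hi => (hf i hi).1.trans (hf i hi).2.1
  have hsmono : ∀ j ≤ n, ∀ i ≤ j, s i ≤ s j := by
    intro j hj i hij
    induction j, hij using Nat.le_induction with
    | base => exact le_rfl
    | succ k hk ih => exact (ih (by omega)).trans (hs k (by omega))
  set e : ℕ → Y →L[ℝ] F := fun i =>
    (v (s (i + 1)) - v (s i)) • B (τ i) - (Φ (s (i + 1)) - Φ (s i)) with he
  have hE : ∀ k ≤ n, ‖∑ i ∈ Finset.range k, e i‖ ≤ ε / c := fun k hk =>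
    H n s τ (Finset.range k) h0 hn hs fun i hi => by
      have := Finset.mem_range.1 hi
      exact ⟨by omega, hf i (by omega)⟩
  -- The tags, completed by `θ n = b` to supply the boundary term of the Abel summation.
  set θ : ℕ → ℝ := fun i => if i < n then τ i else b with hθ
  have hθn : θ n = b := by simp [hθ]
  have hθa : ∀ i ≤ n, a ≤ θ i ∧ θ i ≤ b := by
    intro i hi
    rcases hi.lt_or_eq with hi | rfl
    · simp only [hθ, if_pos hi]
      refine ⟨?_, ?_⟩
      · rw [← h0]; exact (hsmono i hi.le 0 (by omega)).trans (hf i hi).1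
      · rw [← hn]; exact (hf i hi).2.1.trans (hsmono n le_rfl (i + 1) hi)
    · rw [hθn]; exact ⟨hab, le_rfl⟩
  have hθs : ∀ i < n, θ i ≤ θ (i + 1) := by
    intro i hi
    by_cases hi' : i + 1 < n
    · simp only [hθ, if_pos hi, if_pos hi']
      exact (hf i hi).2.1.trans (hf _ hi').1
    · obtain rfl : i + 1 = n := by omega
      rw [hθn]
      exact (hθa i hi.le).2
  have hsum : ∑ i ∈ Finset.range n,
      ((v (s (i + 1)) - v (s i)) • B (τ i) (ξ (τ i)) - (Φ (s (i + 1)) - Φ (s i)) (ξ (τ i)))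
      = ∑ i ∈ Finset.range n, e i (ξ (θ i)) := by
    refine Finset.sum_congr rfl fun i hi => ?_
    simp [he, hθ, Finset.mem_range.1 hi]
  rw [hsum, sum_clm_apply_by_parts e (fun i => ξ (θ i)) n]
  have h1 : ‖(∑ i ∈ Finset.range n, e i) (ξ (θ n))‖ ≤ ε / c * ‖ξ b‖ := by
    rw [hθn]
    exact ((∑ i ∈ Finset.range n, e i).le_opNorm _).trans (by gcongr; exact hE n le_rfl)
  have h2 : ‖∑ i ∈ Finset.range n, (∑ j ∈ Finset.range (i + 1), e j) (ξ (θ (i + 1)) - ξ (θ i))‖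
      ≤ ε / c * (ρ b - ρ a) := by
    calc _ ≤ ∑ i ∈ Finset.range n, ε / c * (ρ (θ (i + 1)) - ρ (θ i)) := by
          refine norm_sum_le_of_le _ fun i hi => ?_
          have hi := Finset.mem_range.1 hi
          refine ((∑ j ∈ Finset.range (i + 1), e j).le_opNorm _).trans ?_
          gcongr
          · exact hE _ hi
          · exact hρ _ _ (hθa i hi.le).1 (hθs i hi) (hθa _ hi).2
      _ = ε / c * (ρ b - ρ (θ 0)) := by
          rw [← Finset.mul_sum, Finset.sum_range_sub (fun i => ρ (θ i)), hθn]
      _ ≤ _ := by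
          gcongr
          exact hmono _ _ le_rfl (hθa 0 (by omega)).1 (hθa 0 (by omega)).2
  calc _ ≤ ε / c * ‖ξ b‖ + ε / c * (ρ b - ρ a) := (norm_sub_le _ _).trans (add_le_add h1 h2)
    _ ≤ ε / c * c := by
        rw [← mul_add]
        gcongr
        linarith
    _ = ε := div_mul_cancel₀ _ hc0.ne'

theorem exists_norm_rightLimit_le {E : Type*} [NormedAddCommGroup E] {h w : ℝ → E}
    (hl : ∀ t, ContinuousWithinAt h (Iic t) t)
    (hr : ∀ t, Tendsto h (𝓝[>] t) (𝓝 (w t))) (a b : ℝ) : ∃ M, ∀ t ∈ Icc a b, ‖w t‖ ≤ M := by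
  refine isCompact_Icc.induction_on (p := fun s => ∃ M, ∀ t ∈ s, ‖w t‖ ≤ M) ⟨0, by simp⟩
    (fun s t hst ⟨M, hM⟩ => ⟨M, fun x hx => hM x (hst hx)⟩)
    (fun s t ⟨M, hM⟩ ⟨M', hM'⟩ => ⟨max M M', fun x hx => hx.elim
      (fun h => (hM x h).trans (le_max_left _ _)) fun h => (hM' x h).trans (le_max_right _ _)⟩) ?_
  intro t _
  set M := max (‖h t‖ + 1) (‖w t‖ + 1)
  have h1 : ∀ᶠ s in 𝓝[≤] t, ‖h s‖ ≤ M :=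
    ((hl t).norm.eventually_lt_const (lt_add_one _)).mono
      fun s hs => hs.le.trans (le_max_left _ _)
  have h2 : ∀ᶠ s in 𝓝[>] t, ‖h s‖ ≤ M :=
    ((hr t).norm.eventually_lt_const (lt_add_one _)).mono
      fun s hs => hs.le.trans (le_max_right _ _)
  have h3 : ∀ᶠ s in 𝓝 t, ‖h s‖ ≤ M := by
    rw [← nhdsLE_sup_nhdsGT t]
    exact eventually_sup.2 ⟨h1, h2⟩
  refine ⟨{s | ∀ᶠ r in 𝓝 s, ‖h r‖ ≤ M}, mem_nhdsWithin_of_mem_nhds h3.eventually_nhds, M,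
    fun s hs => ?_⟩
  exact le_of_tendsto (hr s).norm (Eventually.filter_mono nhdsWithin_le_nhds hs)

/-- Integration by parts: integral of a Perron-Stieltjes integrable operator function against
a function with a Bochner density. -/
theorem HasPrimitive.hasStieltjes_clm_apply (hB : HasPrimitive B v Φ) {μ : Measure ℝ}
    (hl : ∀ t, ContinuousWithinAt Φ (Iic t) t) (hr : ∀ t, Tendsto Φ (𝓝[>] t) (𝓝 (Φ' t)))
    {φ ξ : ℝ → Y} (hφ : ∀ p q, IntegrableOn φ (Ico p q) μ)
    (hξ : ∀ p q, p ≤ q → ξ q - ξ p = ∫ r in Ico p q, φ r ∂μ) [CompleteSpace Y] [CompleteSpace F]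
    {a b : ℝ} (hab : a ≤ b) :
    IntegrableOn (fun r => Φ' r (φ r)) (Ico a b) μ ∧
    HasStieltjes (fun t => B t (ξ t)) v a b
      (Φ b (ξ b) - Φ a (ξ a) - ∫ r in Ico a b, Φ' r (φ r) ∂μ) := by
  have hint : ∀ p q, IntegrableOn (fun r => Φ' r (φ r)) (Ico p q) μ := by
    intro p q
    obtain ⟨M, hM⟩ := exists_norm_rightLimit_le hl hr p q
    refine ((hφ p q).norm.const_mul M).mono' ?_ ?_
    · exact (ContinuousLinearMap.id ℝ (Y →L[ℝ] F)).aestronglyMeasurable_comp₂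
        (stronglyMeasurable_of_tendsto_nhdsGT hr).aestronglyMeasurable (hφ p q).1
    · refine (ae_restrict_mem measurableSet_Ico).mono fun r hrI => ?_
      exact ((Φ' r).le_opNorm _).trans (by gcongr; exact hM r (Ico_subset_Icc_self hrI))
  refine ⟨hint a b, fun ε hε => ?_⟩
  set I := ∫ r in Ico a b, ‖φ r‖ ∂μ with hI
  have hI0 : 0 ≤ I := integral_nonneg fun _ => norm_nonneg _
  set κ := ε / (4 * (I + 1)) with hκ
  have hκ0 : 0 < κ := by positivity
  obtain ⟨δ, hδ, H⟩ := hB.exists_gauge_clm_apply hab (ξ := ξ)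
    (ρ := fun t => ∫ r in Ico a t, ‖φ r‖ ∂μ) (fun p q hp hpq hq => by
      rw [hξ p q hpq, ← setIntegral_Ico_add hp hpq (hφ a q).norm, add_sub_cancel_left]
      exact norm_integral_le_integral_norm _) (show 0 < ε / 4 by positivity)
  -- `Φ` may jump at `τ`: to its left it is close to `Φ τ`, to its right to `Φ' τ`. Each half of a
  -- cell is therefore treated with its own reference value.
  have hloc : ∀ τ, ∃ d > 0, (∀ r, τ - d < r → r ≤ τ → ‖Φ r - Φ τ‖ ≤ κ) ∧
      ∀ r, τ < r → r < τ + d → ‖Φ r - Φ' τ‖ ≤ κ := by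
    intro τ
    obtain ⟨d₁, hd₁, h₁⟩ := Metric.tendsto_nhdsWithin_nhds.1 (hl τ).tendsto κ hκ0
    obtain ⟨d₂, hd₂, h₂⟩ := Metric.tendsto_nhdsWithin_nhds.1 (hr τ) κ hκ0
    refine ⟨min d₁ d₂, lt_min hd₁ hd₂, fun r h1 h2 => ?_, fun r h1 h2 => ?_⟩
    · rw [← dist_eq_norm]
      refine (h₁ h2 ?_).le
      rw [Real.dist_eq, abs_lt]
      constructor <;> linarith [min_le_left d₁ d₂]
    · rw [← dist_eq_norm]
      refine (h₂ h1 ?_).le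
      rw [Real.dist_eq, abs_lt]
      constructor <;> linarith [min_le_right d₁ d₂]
  choose d hd hdl hdr using hloc
  refine ⟨fun t => min (δ t) (d t), fun t => lt_min (hδ t) (hd t), fun n s τ hD => ?_⟩
  have hHn := H n s τ (hD.mono fun t => min_le_left _ _)
  obtain ⟨h0, hn, hf⟩ := hD.mono (δ' := d) fun t => min_le_right _ _
  have hs : ∀ i < n, s i ≤ s (i + 1) := fun i hi => (hf i hi).1.trans (hf i hi).2.1
  set J : ℕ → F := fun i => Φ (s (i + 1)) (ξ (s (i + 1))) - Φ (s i) (ξ (s i))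
    - ∫ r in Ico (s i) (s (i + 1)), Φ' r (φ r) ∂μ with hJ
  have hJsum : ∑ i ∈ Finset.range n, J i
      = Φ b (ξ b) - Φ a (ξ a) - ∫ r in Ico a b, Φ' r (φ r) ∂μ := by
    rw [hJ, Finset.sum_sub_distrib, Finset.sum_range_sub (fun i => Φ (s i) (ξ (s i))),
      sum_setIntegral_Ico hs (hint _ _), h0, hn]
  have hcell : ∀ i < n, ‖(Φ (s (i + 1)) - Φ (s i)) (ξ (τ i)) - J i‖
      ≤ 2 * κ * ∫ r in Ico (s i) (s (i + 1)), ‖φ r‖ ∂μ := by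
    intro i hi
    have hc : IsFineCell d (τ i) (s i) (s (i + 1)) := hf i hi
    obtain ⟨h1, h2, -⟩ := hf i hi
    have h3 := hc.lt_left
    have h4 := hc.lt_right
    set p := s i
    set q := s (i + 1)
    set t := τ i
    have hleft : ∀ r, t - d t < r → r < t → ‖Φ' r - Φ t‖ ≤ κ := by
      intro r hr1 hr2
      refine le_of_tendsto ((hr r).sub_const (Φ t)).norm ?_
      filter_upwards [Ioo_mem_nhdsGT hr2] with x hx
      exact hdl t x (hr1.trans hx.1) hx.2.le
    have hright : ∀ r, t ≤ r → r < t + d t → ‖Φ' r - Φ' t‖ ≤ κ := by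
      intro r hr1 hr2
      refine le_of_tendsto ((hr r).sub_const (Φ' t)).norm ?_
      filter_upwards [Ioo_mem_nhdsGT hr2] with x hx
      exact hdr t x (hr1.trans_lt hx.1) hx.2
    have e1 : ξ q - ξ t = ∫ r in Ico t q, φ r ∂μ := hξ t q h2
    have e2 : ξ t - ξ p = ∫ r in Ico p t, φ r ∂μ := hξ p t h1
    -- Writing the increments of `ξ` as integrals of `φ`, the error on a cell becomes an integral
    -- over each half of `Φ` at the outer endpoint minus `Φ'`, a difference of norm at most `2 * κ`.
    have hsplit : (Φ q - Φ p) (ξ t) - J i =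
        - ((∫ r in Ico p t, (Φ p - Φ' r) (φ r) ∂μ) + ∫ r in Ico t q, (Φ q - Φ' r) (φ r) ∂μ) := by
      simp only [sub_apply]
      rw [integral_sub ((Φ p).integrable_comp (hφ p t)) (hint p t),
        integral_sub ((Φ q).integrable_comp (hφ t q)) (hint t q),
        (Φ p).integral_comp_comm (hφ p t), (Φ q).integral_comp_comm (hφ t q), ← e1, ← e2]
      simp only [hJ, map_sub]
      rw [← setIntegral_Ico_add h1 h2 (hint p q)]
      abel
    rw [hsplit, norm_neg, ← setIntegral_Ico_add h1 h2 (hφ p q).norm, mul_add]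
    refine (norm_add_le _ _).trans (add_le_add ?_ ?_)
    · rw [← integral_const_mul]
      refine norm_integral_le_of_norm_le ((hφ p t).norm.const_mul _) ?_
      refine (ae_restrict_mem measurableSet_Ico).mono fun r hrI => ?_
      refine ((Φ p - Φ' r).le_opNorm _).trans ?_
      gcongr
      calc ‖Φ p - Φ' r‖ = ‖(Φ p - Φ t) - (Φ' r - Φ t)‖ := by congr 1; abel
        _ ≤ κ + κ := (norm_sub_le _ _).trans
            (add_le_add (hdl t p h3 h1) (hleft r (h3.trans_le hrI.1) hrI.2))
        _ = 2 * κ := by ring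
    · rw [← integral_const_mul]
      refine norm_integral_le_of_norm_le ((hφ t q).norm.const_mul _) ?_
      refine (ae_restrict_mem measurableSet_Ico).mono fun r hrI => ?_
      refine ((Φ q - Φ' r).le_opNorm _).trans ?_
      gcongr
      calc ‖Φ q - Φ' r‖ = ‖(Φ q - Φ' t) - (Φ' r - Φ' t)‖ := by congr 1; abel
        _ ≤ κ + κ := (norm_sub_le _ _).trans (add_le_add (hdr t q (hrI.1.trans_lt hrI.2) h4)
            (hright r hrI.1 (hrI.2.trans h4)))
        _ = 2 * κ := by ring
  have hcells : ‖∑ i ∈ Finset.range n, ((Φ (s (i + 1)) - Φ (s i)) (ξ (τ i)) - J i)‖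
      ≤ ε / 2 := by
    calc _ ≤ ∑ i ∈ Finset.range n, 2 * κ * ∫ r in Ico (s i) (s (i + 1)), ‖φ r‖ ∂μ :=
          norm_sum_le_of_le _ fun i hi => hcell i (Finset.mem_range.1 hi)
      _ = 2 * κ * I := by
          rw [← Finset.mul_sum, sum_setIntegral_Ico hs (hφ _ _).norm, h0, hn]
      _ ≤ 2 * κ * (I + 1) := by gcongr; linarith
      _ = ε / 2 := by rw [hκ]; field_simp; norm_num
  rw [← hJsum]
  calc _ = ‖∑ i ∈ Finset.range n, ((v (s (i + 1)) - v (s i)) • B (τ i) (ξ (τ i))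
          - (Φ (s (i + 1)) - Φ (s i)) (ξ (τ i)))
        + ∑ i ∈ Finset.range n, ((Φ (s (i + 1)) - Φ (s i)) (ξ (τ i)) - J i)‖ := by
        rw [← Finset.sum_add_distrib, ← Finset.sum_sub_distrib]
        congr 1
        refine Finset.sum_congr rfl fun i _ => ?_
        rw [sub_smul]
        abel
    _ ≤ ε / 4 + ε / 2 := (norm_add_le _ _).trans (add_le_add hHn hcells)
    _ < ε := by linarith

end Product

/-! ### The homogeneous linear equation and its fundamental operator -/

section IntegralSum

variable {E F : Type*} [NormedAddCommGroup E] [NormedSpace ℝ E] [NormedAddCommGroup F]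
  [NormedSpace ℝ F] {f₁ f₂ g₁ g₂ w z : ℝ → E} {u : ℝ → ℝ}

/-- `w` is an indefinite integral of `f₁ dt + f₂ du`. -/
def IsPrimitiveSum (f₁ f₂ : ℝ → E) (u : ℝ → ℝ) (w : ℝ → E) : Prop :=
  ∃ Φ₁ Φ₂ : ℝ → E, HasPrimitive f₁ id Φ₁ ∧ HasPrimitive f₂ u Φ₂ ∧
    ∀ a b, w b - w a = Φ₁ b - Φ₁ a + (Φ₂ b - Φ₂ a)

theorem IsPrimitiveSum.sub (hw : IsPrimitiveSum f₁ f₂ u w) (hz : IsPrimitiveSum g₁ g₂ u z) :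
    IsPrimitiveSum (fun t => f₁ t - g₁ t) (fun t => f₂ t - g₂ t) u (fun t => w t - z t) := by
  obtain ⟨Φ₁, Φ₂, h1, h2, h⟩ := hw
  obtain ⟨Ψ₁, Ψ₂, k1, k2, k⟩ := hz
  refine ⟨_, _, h1.sub k1, h2.sub k2, fun a b => ?_⟩
  rw [sub_sub_sub_comm, h, k]
  abel

theorem IsPrimitiveSum.map (L : E →L[ℝ] F) (hw : IsPrimitiveSum f₁ f₂ u w) :
    IsPrimitiveSum (fun t => L (f₁ t)) (fun t => L (f₂ t)) u (fun t => L (w t)) := by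
  obtain ⟨Φ₁, Φ₂, h1, h2, h⟩ := hw
  refine ⟨_, _, h1.map L, h2.map L, fun a b => ?_⟩
  simp only [← map_sub, ← map_add, h]

theorem IsPrimitiveSum.continuousWithinAt_Iic (hw : IsPrimitiveSum f₁ f₂ u w)
    (hu : ∀ t, ContinuousWithinAt u (Iic t) t) (t : ℝ) : ContinuousWithinAt w (Iic t) t := by
  obtain ⟨Φ₁, Φ₂, h1, h2, h⟩ := hw
  have := ((h1.continuousWithinAt_Iic (t := t) continuousWithinAt_id).add
    (h2.continuousWithinAt_Iic (hu t))).add (continuousWithinAt_const (b := w t - Φ₁ t - Φ₂ t))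
  refine this.congr (fun s _ => ?_) ?_
  · have := h t s
    simp only [Pi.add_apply]
    rw [sub_eq_iff_eq_add] at this
    rw [this]; abel
  · simp only [Pi.add_apply]; abel

theorem IsPrimitiveSum.tendsto_nhdsGT (hw : IsPrimitiveSum f₁ f₂ u w) {t d : ℝ}
    (hu : Tendsto u (𝓝[>] t) (𝓝 (u t + d))) :
    Tendsto w (𝓝[>] t) (𝓝 (w t + d • f₂ t)) := by
  obtain ⟨Φ₁, Φ₂, h1, h2, h⟩ := hw
  have e1 := h1.tendsto_nhdsGT (t := t) (d := 0)
    (by simpa using (tendsto_id.mono_left nhdsWithin_le_nhds : Tendsto id (𝓝[>] t) (𝓝 t)))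
  have := (e1.add (h2.tendsto_nhdsGT hu)).add_const (w t - Φ₁ t - Φ₂ t)
  refine (this.congr fun s => ?_).trans (le_of_eq ?_)
  · have := h t s
    rw [sub_eq_iff_eq_add] at this
    rw [this]; abel
  · congr 1
    rw [zero_smul]
    abel

end IntegralSum

section Linear

variable {X : Type*} [NormedAddCommGroup X] [NormedSpace ℝ X] {A C : ℝ → X →L[ℝ] X} {u : ℝ → ℝ}
  {hu : Monotone u}

/-- The measure `ν` dominates the coefficients of `Dx = A(t)x + C(t)x Du`. -/
def IsMajorant (A C : ℝ → X →L[ℝ] X) (u : ℝ → ℝ) (ν : Measure ℝ) : Prop :=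
  ∀ (y w : ℝ → X), (∀ t, ContinuousWithinAt y (Iic t) t) →
    IsPrimitiveSum (fun t => A t (y t)) (fun t => C t (y t)) u w →
    ∀ a b M, a ≤ b → (∀ s ∈ Icc a b, ‖y s‖ ≤ M) → ‖w b - w a‖ ≤ M * ν.real (Ico a b)

theorem withDensity_abs_Ico {μ : Measure ℝ} {m : ℝ → ℝ} {a b : ℝ}
    (hm : IntegrableOn m (Ico a b) μ) :
    (μ.withDensity fun s => ENNReal.ofReal |m s|) (Ico a b)
      = ENNReal.ofReal (∫ s in Ico a b, |m s| ∂μ) := by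
  rw [withDensity_apply _ measurableSet_Ico,
    ofReal_integral_eq_lintegral_ofReal hm.abs (Eventually.of_forall fun _ => abs_nonneg _)]

theorem IsAdmissible.isStieltjesMeasure (h : IsAdmissible A C u hu) :
    IsStieltjesMeasure u (duMeasure u hu) :=
  isStieltjesMeasure_duMeasure hu h.left_continuous

instance (u : ℝ → ℝ) (hu : Monotone u) : IsLocallyFiniteMeasure (duMeasure u hu) := by
  unfold duMeasure; infer_instance

theorem IsAdmissible.hasPrimitive_A (h : IsAdmissible A C u hu) :
    HasPrimitive A id (fun t => psIntegral A id 0 t) :=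
  hasPrimitive_psIntegral 0 (h.perron_integrable 0)

theorem IsAdmissible.hasPrimitive_C (h : IsAdmissible A C u hu) :
    HasPrimitive C u (fun t => psIntegral C u 0 t) :=
  hasPrimitive_psIntegral 0 (h.perronStieltjes_integrable 0)

theorem IsAdmissible.exists_majorant (h : IsAdmissible A C u hu) :
    ∃ ν : Measure ℝ, (∀ a b, ν (Ico a b) ≠ ⊤) ∧ IsMajorant A C u ν ∧
      ∀ a b, a ≤ b → ‖coeffPrimitive A C u b - coeffPrimitive A C u a‖ ≤ ν.real (Ico a b) := by
  obtain ⟨m₁, hm₁⟩ := h.bound_A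
  obtain ⟨m₂, hm₂⟩ := h.bound_C
  set μ := duMeasure u hu
  have hA := h.hasPrimitive_A
  have hC := h.hasPrimitive_C
  have hA' : ∀ c d, c ≤ d → ‖psIntegral A id 0 d - psIntegral A id 0 c‖
      ≤ ∫ s in Ico c d, |m₁ s| := fun c d hcd => by
    rw [← (hA.hasPSIntegral c d).psIntegral_eq]
    exact (hm₁ c d hcd).2.trans (integral_mono (hm₁ c d hcd).1 (hm₁ c d hcd).1.abs
      fun s => le_abs_self _)
  have hC' : ∀ c d, c ≤ d → ‖psIntegral C u 0 d - psIntegral C u 0 c‖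
      ≤ ∫ s in Ico c d, |m₂ s| ∂μ := fun c d hcd => by
    rw [← (hC.hasPSIntegral c d).psIntegral_eq]
    exact (hm₂ c d hcd).2.trans (integral_mono (hm₂ c d hcd).1 (hm₂ c d hcd).1.abs
      fun s => le_abs_self _)
  set ν := (volume.withDensity fun s => ENNReal.ofReal |m₁ s|)
    + μ.withDensity fun s => ENNReal.ofReal |m₂ s| with hν
  have hνI : ∀ a b, a ≤ b → ν (Ico a b) = ENNReal.ofReal ((∫ s in Ico a b, |m₁ s|)
      + ∫ s in Ico a b, |m₂ s| ∂μ) := by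
    intro a b hab
    rw [hν, Measure.add_apply, withDensity_abs_Ico (hm₁ a b hab).1,
      withDensity_abs_Ico (hm₂ a b hab).1, ENNReal.ofReal_add] <;>
    exact integral_nonneg fun _ => abs_nonneg _
  have hνr : ∀ a b, a ≤ b → ν.real (Ico a b) = (∫ s in Ico a b, |m₁ s|)
      + ∫ s in Ico a b, |m₂ s| ∂μ := by
    intro a b hab
    rw [measureReal_def, hνI a b hab, ENNReal.toReal_ofReal]
    exact add_nonneg (integral_nonneg fun _ => abs_nonneg _) (integral_nonneg fun _ => abs_nonneg _)
  refine ⟨ν, fun a b => ?_, ?_, fun a b hab => ?_⟩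
  · rcases le_or_gt a b with hab | hab
    · rw [hνI a b hab]; exact ENNReal.ofReal_ne_top
    · simp [hab.le]
  · rintro y w hy ⟨Φ₁, Φ₂, h1, h2, hw⟩ a b M hab hM
    rw [hw, hνr a b hab, mul_add]
    refine (norm_add_le _ _).trans (add_le_add ?_ ?_)
    · exact isStieltjesMeasure_id.norm_hasStieltjes_clm_le hA (fun _ => abs_nonneg _)
        (fun c d hcd => (hm₁ c d hcd).1.abs) hA' hy hab (h1 a b hab) hM
    · exact h.isStieltjesMeasure.norm_hasStieltjes_clm_le hC (fun _ => abs_nonneg _)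
        (fun c d hcd => (hm₂ c d hcd).1.abs) hC' hy hab (h2 a b hab) hM
  · rw [hνr a b hab, coeffPrimitive, coeffPrimitive, add_sub_add_comm]
    exact (norm_add_le _ _).trans (add_le_add (hA' a b hab) (hC' a b hab))

/-- A possible atom at `t` is avoided: `t` lies neither in the left interval nor in the right ones,
and the enclosing intervals shrink to the empty set. -/
theorem exists_real_Ico_le_half {ν : Measure ℝ} (hν : ∀ a b, ν (Ico a b) ≠ ⊤) (t : ℝ) :
    ∃ h > 0, ν.real (Ico (t - h) t) ≤ 1 / 2 ∧ ∀ r, t < r → ν.real (Ico r (t + h)) ≤ 1 / 2 := by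
  have half : (0 : ENNReal) < ENNReal.ofReal (1 / 2) := by simp
  have lim : ∀ S : ℕ → Set ℝ, (∀ n, MeasurableSet (S n)) → Antitone S → (⋂ n, S n) = ∅ →
      ν (S 0) ≠ ⊤ → ∀ᶠ n in atTop, ν (S n) < ENNReal.ofReal (1 / 2) := by
    intro S hS hanti hemp hfin
    have := tendsto_measure_iInter_atTop (fun n => (hS n).nullMeasurableSet) hanti ⟨0, hfin⟩
    rw [hemp, measure_empty] at this
    exact this.eventually_lt_const half
  have hn : ∀ {m n : ℕ}, m ≤ n → 1 / ((n : ℝ) + 1) ≤ 1 / ((m : ℝ) + 1) :=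
    fun h => Nat.one_div_le_one_div h
  have h1 := lim (fun n => Ico (t - 1 / ((n : ℝ) + 1)) t) (fun n => measurableSet_Ico)
    (fun m n hmn => Ico_subset_Ico_left (by linarith [hn hmn]))
    (by
      refine eq_empty_of_forall_notMem fun x hx => ?_
      have hx := mem_iInter.1 hx
      obtain ⟨n, hn⟩ := exists_nat_one_div_lt (sub_pos.2 (hx 0).2)
      linarith [(hx n).1]) (hν _ _)
  have h2 := lim (fun n => Ioo t (t + 1 / ((n : ℝ) + 1))) (fun n => measurableSet_Ioo)
    (fun m n hmn => Ioo_subset_Ioo_right (by linarith [hn hmn]))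
    (by
      refine eq_empty_of_forall_notMem fun x hx => ?_
      have hx := mem_iInter.1 hx
      obtain ⟨n, hn⟩ := exists_nat_one_div_lt (sub_pos.2 (hx 0).1)
      linarith [(hx n).2])
    (ne_top_of_le_ne_top (hν _ _) (measure_mono Ioo_subset_Ico_self))
  obtain ⟨n, hn1, hn2⟩ := (h1.and h2).exists
  refine ⟨1 / ((n : ℝ) + 1), by positivity, ?_, fun r hr => ?_⟩
  · exact ENNReal.toReal_le_of_le_ofReal (by norm_num) hn1.le
  · have hsub : Ico r (t + 1 / ((n : ℝ) + 1)) ⊆ Ioo t (t + 1 / ((n : ℝ) + 1)) :=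
      fun x hx => ⟨hr.trans_le hx.1, hx.2⟩
    exact ENNReal.toReal_le_of_le_ofReal (by norm_num) ((measure_mono hsub).trans hn2.le)

/-- The jump operators `1 + d C(t)`, with `d` the jump of `u` at `t`, are invertible. -/
theorem IsAdmissible.exists_jump (h : IsAdmissible A C u hu) (t : ℝ) :
    ∃ d : ℝ, Tendsto u (𝓝[>] t) (𝓝 (u t + d)) ∧ IsUnit (1 + d • C t) := by
  have h1 := hu.tendsto_rightLim t
  refine ⟨Function.rightLim u t - u t, by simpa using h1, ?_⟩
  by_cases hc : ContinuousAt u t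
  · have := tendsto_nhds_unique h1 (hc.tendsto.mono_left nhdsWithin_le_nhds)
    simp [this]
  · obtain ⟨J, hJ, hunit⟩ := h.jump t hc
    have h2 := (h.hasPrimitive_C.tendsto_nhdsGT (t := t)
      (d := Function.rightLim u t - u t) (by simpa using h1)).sub_const (psIntegral C u 0 t)
    have h3 : (fun r => psIntegral C u t r)
        = fun r => psIntegral C u 0 r - psIntegral C u 0 t :=
      funext fun r => (h.hasPrimitive_C.hasPSIntegral t r).psIntegral_eq
    rw [h3] at hJ
    rwa [tendsto_nhds_unique hJ h2, add_sub_cancel_left] at hunit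

/-- `w` solves the homogeneous equation `Dw = A(t)w + C(t)w Du`. -/
abbrev IsHomogeneousSolution (A C : ℝ → X →L[ℝ] X) (u : ℝ → ℝ) (w : ℝ → X) : Prop :=
  IsPrimitiveSum (fun t => A t (w t)) (fun t => C t (w t)) u w

/-- Plays the role of a Gronwall inequality wherever the coefficients have mass or variation at most
`1/2`. -/
theorem forall_eq_zero_of_half_bound {E : Type*} [NormedAddCommGroup E] {S : Set ℝ} {w : ℝ → E} {M₀ : ℝ}
    (h₀ : ∀ t ∈ S, ‖w t‖ ≤ M₀)
    (h : ∀ M, (∀ t ∈ S, ‖w t‖ ≤ M) → ∀ t ∈ S, ‖w t‖ ≤ M / 2) : ∀ t ∈ S, w t = 0 := by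
  have hn : ∀ n : ℕ, ∀ t ∈ S, ‖w t‖ ≤ M₀ * (1 / 2) ^ n := by
    intro n
    induction n with
    | zero => simpa using h₀
    | succ n ih =>
      intro t ht
      have := h _ ih t ht
      rw [pow_succ]
      linarith
  intro t ht
  have hlim : Tendsto (fun n : ℕ => M₀ * (1 / 2 : ℝ) ^ n) atTop (𝓝 (M₀ * 0)) :=
    (tendsto_pow_atTop_nhds_zero_of_lt_one (by norm_num) (by norm_num)).const_mul _
  rw [mul_zero] at hlim
  exact norm_le_zero_iff.1 (ge_of_tendsto' hlim fun n => hn n t ht)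

/-- Uniqueness for the homogeneous linear equation. -/
theorem IsAdmissible.eq_zero (h : IsAdmissible A C u hu) {w : ℝ → X}
    (hw : IsHomogeneousSolution A C u w) {t₀ : ℝ} (h₀ : w t₀ = 0) (t : ℝ) : w t = 0 := by
  obtain ⟨ν, hν, hmaj, -⟩ := h.exists_majorant
  have hl := hw.continuousWithinAt_Iic h.left_continuous
  -- The right limit at `t` is `(1 + d • C t) (w t)`, and invertibility of the jump operator lets
  -- its vanishing force `w t = 0`. With left continuity, this makes the zero set both open and
  -- closed.
  have hright : ∀ t, w t = 0 ↔ Tendsto w (𝓝[>] t) (𝓝 0) := by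
    intro t
    obtain ⟨d, hd, hunit⟩ := h.exists_jump t
    have h1 := hw.tendsto_nhdsGT hd
    constructor
    · intro hz
      simpa [hz] using h1
    · intro hz
      have h2 : (1 + d • C t) (w t) = 0 := by
        simpa using tendsto_nhds_unique h1 hz
      obtain ⟨V, hV⟩ := hunit
      rw [← hV] at h2
      calc w t = (↑V⁻¹ * (V : X →L[ℝ] X)) (w t) := by rw [Units.inv_mul]; rfl
        _ = (↑V⁻¹ : X →L[ℝ] X) ((V : X →L[ℝ] X) (w t)) := rfl
        _ = 0 := by rw [h2, map_zero]
  have hcont : ∀ t, w t = 0 → Tendsto w (𝓝 t) (𝓝 0) := by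
    intro t hz
    rw [← nhdsLE_sup_nhdsGT t, tendsto_sup]
    exact ⟨by simpa [ContinuousWithinAt, hz] using hl t, (hright t).1 hz⟩
  have hopen : IsOpen {t | w t = 0} := by
    rw [isOpen_iff_mem_nhds]
    intro t hz
    obtain ⟨h₁, hh₁, hν₁, hν₂⟩ := exists_real_Ico_le_half hν t
    obtain ⟨h₂, hh₂, hb⟩ := Metric.tendsto_nhds_nhds.1 (hcont t hz) 1 one_pos
    set k := min h₁ h₂ / 2 with hk
    have hk0 : 0 < k := half_pos (lt_min hh₁ hh₂)
    have hk1 : k < h₁ := by have := min_le_left h₁ h₂; have := lt_min hh₁ hh₂; linarith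
    have hk2 : k < h₂ := by have := min_le_right h₁ h₂; have := lt_min hh₁ hh₂; linarith
    have hbd : ∀ s ∈ Icc (t - k) (t + k), ‖w s‖ ≤ 1 := by
      intro s hs
      have := hb (x := s) (by rw [Real.dist_eq, abs_lt]; constructor <;> linarith [hs.1, hs.2])
      rw [dist_zero_right] at this
      exact this.le
    have hL : ∀ s ∈ Icc (t - k) t, w s = 0 := by
      refine forall_eq_zero_of_half_bound (M₀ := 1)
        (fun s hs => hbd s ⟨hs.1, by linarith [hs.2]⟩) fun M hM s hs => ?_
      have h1 := hmaj w w hl hw s t M hs.2 fun r hr => hM r ⟨hs.1.trans hr.1, hr.2⟩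
      rw [show w t = 0 from hz, zero_sub, norm_neg] at h1
      have hM0 : 0 ≤ M := (norm_nonneg _).trans (hM s hs)
      have h2 : ν.real (Ico s t) ≤ 1 / 2 :=
        (measureReal_mono (Ico_subset_Ico_left (by linarith [hs.1])) (hν _ _)).trans hν₁
      nlinarith
    -- As `ν` may charge `t`, the estimate is made on `[r, s]` and `r` decreases to `t`, where `w r
    -- → 0`.
    have hR : ∀ s ∈ Ioc t (t + k), w s = 0 := by
      refine forall_eq_zero_of_half_bound (M₀ := 1)
        (fun s hs => hbd s ⟨by linarith [hs.1], hs.2⟩) fun M hM s hs => ?_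
      have hM0 : 0 ≤ M := (norm_nonneg _).trans (hM s hs)
      have h3 : Tendsto (fun r => ‖w s - w r‖) (𝓝[>] t) (𝓝 ‖w s - 0‖) :=
        (((hright t).1 hz).const_sub (w s)).norm
      rw [sub_zero] at h3
      refine le_of_tendsto h3 ?_
      filter_upwards [Ioo_mem_nhdsGT hs.1] with r hr
      have h1 := hmaj w w hl hw r s M hr.2.le fun q hq => hM q ⟨hr.1.trans_le hq.1, hq.2.trans hs.2⟩
      have h2 : ν.real (Ico r s) ≤ 1 / 2 :=
        (measureReal_mono (Ico_subset_Ico_right (by linarith [hs.2])) (hν _ _)).trans (hν₂ r hr.1)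
      nlinarith
    filter_upwards [Icc_mem_nhds (show t - k < t by linarith) (show t < t + k by linarith)]
      with s hs
    rcases le_or_gt s t with hst | hst
    · exact hL s ⟨hs.1, hst⟩
    · exact hR s ⟨hst, hs.2⟩
  have hclosed : IsClosed {t | w t = 0} := by
    rw [← isOpen_compl_iff, isOpen_iff_mem_nhds]
    intro t ht
    rw [← nhdsLE_sup_nhdsGT t, mem_sup]
    refine ⟨(hl t).eventually_ne ht, ?_⟩
    obtain ⟨d, hd, -⟩ := h.exists_jump t
    have h1 := hw.tendsto_nhdsGT hd
    refine h1.eventually_ne fun h2 => ht ?_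
    rw [h2] at h1
    exact (hright t).2 h1
  have := IsClopen.eq_univ ⟨hclosed, hopen⟩ ⟨t₀, h₀⟩
  exact (this ▸ mem_univ t : t ∈ {t | w t = 0})

section Fundamental

variable {U : ℝ → ℝ → X →L[ℝ] X}

theorem IsFundamentalOperator.isPrimitiveSum (hU : IsFundamentalOperator A C u U) (s : ℝ) :
    IsPrimitiveSum (fun t => A t * U t s) (fun t => C t * U t s) u (fun t => U t s) := by
  refine ⟨_, _, hasPrimitive_psIntegral s fun t => (hU t s).1,
    hasPrimitive_psIntegral s fun t => (hU t s).2.1, fun a b => ?_⟩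
  simp only
  rw [(hU a s).2.2, (hU b s).2.2]
  abel

theorem IsFundamentalOperator.self (hU : IsFundamentalOperator A C u U) (s : ℝ) : U s s = 1 := by
  have h1 := ((hasPrimitive_psIntegral s fun t => (hU t s).1).hasPSIntegral s s).psIntegral_eq
  have h2 := ((hasPrimitive_psIntegral s fun t => (hU t s).2.1).hasPSIntegral s s).psIntegral_eq
  rw [(hU s s).2.2, h1, h2]
  simp

theorem IsFundamentalOperator.isHomogeneousSolution (hU : IsFundamentalOperator A C u U) (s : ℝ)
    (x : X) : IsHomogeneousSolution A C u (fun t => U t s x) :=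
  (hU.isPrimitiveSum s).map (ContinuousLinearMap.apply ℝ X x)

theorem IsAdmissible.eq_fundamental (h : IsAdmissible A C u hu)
    (hU : IsFundamentalOperator A C u U) {w : ℝ → X} (hw : IsHomogeneousSolution A C u w)
    (s t : ℝ) : w t = U t s (w s) := by
  have h1 := hw.sub (hU.isHomogeneousSolution s (w s))
  simp only [← map_sub] at h1
  exact sub_eq_zero.1 (h.eq_zero h1 (t₀ := s) (by rw [hU.self]; simp) t)

theorem IsAdmissible.fundamental_mul (h : IsAdmissible A C u hu)
    (hU : IsFundamentalOperator A C u U) (t s r : ℝ) : U t s * U s r = U t r := by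
  ext x
  exact (h.eq_fundamental hU (hU.isHomogeneousSolution r x) s t).symm

theorem IsAdmissible.fundamental_mul_inv (h : IsAdmissible A C u hu)
    (hU : IsFundamentalOperator A C u U) (t s : ℝ) : U t s * U s t = 1 := by
  rw [h.fundamental_mul hU, hU.self]

/-- The jump formula gives the right limit `(1 + d • C t) * U t 0`, which is invertible. Inversion
is continuous at units of a Banach algebra, so the inverses `U 0 r` converge too. -/
theorem IsAdmissible.exists_rightLimits [CompleteSpace X] (h : IsAdmissible A C u hu)
    (hU : IsFundamentalOperator A C u U) : ∃ V W : ℝ → X →L[ℝ] X,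
      (∀ t, Tendsto (fun r => U r 0) (𝓝[>] t) (𝓝 (V t))) ∧
      (∀ t, Tendsto (fun r => U 0 r) (𝓝[>] t) (𝓝 (W t))) ∧ ∀ t, V t * W t = 1 := by
  have key : ∀ t, ∃ V W : X →L[ℝ] X, Tendsto (fun r => U r 0) (𝓝[>] t) (𝓝 V) ∧
      Tendsto (fun r => U 0 r) (𝓝[>] t) (𝓝 W) ∧ V * W = 1 := by
    intro t
    obtain ⟨d, hd, hunit⟩ := h.exists_jump t
    have h1 := (hU.isPrimitiveSum 0).tendsto_nhdsGT hd
    have hUt : IsUnit (U t 0) :=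
      ⟨⟨U t 0, U 0 t, h.fundamental_mul_inv hU _ _, h.fundamental_mul_inv hU _ _⟩, rfl⟩
    have e : U t 0 + d • (C t * U t 0) = (1 + d • C t) * U t 0 := by
      rw [add_mul, one_mul, smul_mul_assoc]
    rw [e] at h1
    obtain ⟨V, hV⟩ := hunit.mul hUt
    rw [← hV] at h1
    refine ⟨V, ↑V⁻¹, h1, ?_, V.mul_inv⟩
    have h2 := (NormedRing.inverse_continuousAt V).tendsto.comp h1
    rw [Ring.inverse_unit] at h2
    refine h2.congr fun r => ?_
    have : U r 0 = ((⟨U r 0, U 0 r, h.fundamental_mul_inv hU _ _,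
      h.fundamental_mul_inv hU _ _⟩ : (X →L[ℝ] X)ˣ) : X →L[ℝ] X) := rfl
    simp only [Function.comp]
    rw [this, Ring.inverse_unit]
    rfl
  choose V W hV hW hVW using key
  exact ⟨V, W, hV, hW, hVW⟩

end Fundamental

end Linear

/-! ### Forcing terms and the Green operator -/

theorem exists_hasPrimitive {E : Type*} [NormedAddCommGroup E] [NormedSpace ℝ E] {f : ℝ → E}
    {v : ℝ → ℝ} (h : ∀ a b, a ≤ b → ∃ J, HasStieltjes f v a b J) : ∃ Φ, HasPrimitive f v Φ := by
  refine ⟨_, hasPrimitive_psIntegral 0 fun t => ?_⟩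
  rcases le_or_gt 0 t with ht | ht
  · obtain ⟨J, hJ⟩ := h 0 t ht
    exact ⟨J, Or.inl ⟨ht, hJ⟩⟩
  · obtain ⟨J, hJ⟩ := h t 0 ht.le
    exact ⟨-J, Or.inr ⟨ht, by rwa [neg_neg]⟩⟩

/-- For simple `x` the composition is a finite sum of indicators of the functions `H · z`. The
Lipschitz bound passes to pointwise limits. -/
theorem aestronglyMeasurable_comp_lipschitz {X : Type*} [NormedAddCommGroup X] {μ : Measure ℝ}
    {H : ℝ → X → X} {L : ℝ} (hm : ∀ z, AEStronglyMeasurable (fun t => H t z) μ)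
    (hL : ∀ t x y, ‖H t x - H t y‖ ≤ L * ‖x - y‖) {x : ℝ → X} (hx : StronglyMeasurable x) :
    AEStronglyMeasurable (fun t => H t (x t)) μ := by
  refine aestronglyMeasurable_of_tendsto_ae atTop (f := fun n t => H t (hx.approx n t)) ?_ ?_
  · intro n
    classical
    set φ := hx.approx n
    have : (fun t => H t (φ t))
        = fun t => ∑ z ∈ φ.range, indicator (φ ⁻¹' {z}) (fun s => H s z) t := by
      funext t
      rw [Finset.sum_eq_single (φ t)]
      · rw [indicator_of_mem (by simp)]
      · intro z _ hz
        exact indicator_of_notMem (fun h => hz h.symm) _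
      · intro h
        exact absurd (φ.mem_range_self t) h
    rw [this]
    exact Finset.aestronglyMeasurable_fun_sum _ fun z _ =>
      (hm z).indicator (φ.measurableSet_fiber z)
  · refine Eventually.of_forall fun t => ?_
    rw [tendsto_iff_norm_sub_tendsto_zero]
    have h1 := (tendsto_iff_norm_sub_tendsto_zero.1 (hx.tendsto_approx t)).const_mul L
    rw [mul_zero] at h1
    exact squeeze_zero (fun _ => norm_nonneg _) (fun n => hL _ _ _) h1

/-- A bounded measurable forcing term. -/
def IsForcing {E : Type*} [NormedAddCommGroup E] (μ : Measure ℝ) (f : ℝ → E) : Prop :=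
  AEStronglyMeasurable f μ ∧ ∃ B, ∀ t, ‖f t‖ ≤ B

theorem IsForcing.sub {E : Type*} [NormedAddCommGroup E] {μ : Measure ℝ} {f g : ℝ → E}
    (hf : IsForcing μ f) (hg : IsForcing μ g) : IsForcing μ (fun t => f t - g t) := by
  obtain ⟨hf, B, hB⟩ := hf
  obtain ⟨hg, B', hB'⟩ := hg
  exact ⟨hf.sub hg, B + B', fun t => (norm_sub_le _ _).trans (add_le_add (hB t) (hB' t))⟩

theorem IsForcing.integrable {E : Type*} [NormedAddCommGroup E] {μ : Measure ℝ} {f : ℝ → E}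
    [IsFiniteMeasure μ] (hf : IsForcing μ f) : Integrable f μ := by
  obtain ⟨hf, B, hB⟩ := hf
  exact .of_bound hf B (Eventually.of_forall hB)

section Green

variable {X : Type*} [NormedAddCommGroup X] [NormedSpace ℝ X] {A C : ℝ → X →L[ℝ] X} {u : ℝ → ℝ}
  {hu : Monotone u} {U : ℝ → ℝ → X →L[ℝ] X} {P : X →L[ℝ] X} {K α : ℝ}

/-- `x` solves the inhomogeneous equation `Dx = A(t)x + C(t)x Du + f(t) Du`. -/
def IsForcedSolution (A C : ℝ → X →L[ℝ] X) (u : ℝ → ℝ) (μ : Measure ℝ) (f x : ℝ → X) : Prop :=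
  ∃ w, IsPrimitiveSum (fun t => A t (x t)) (fun t => C t (x t)) u w ∧
    ∀ a b, a ≤ b → x b - x a = w b - w a + ∫ s in Ico a b, f s ∂μ

theorem IsForcedSolution.sub {μ : Measure ℝ} {f x y : ℝ → X}
    (hx : IsForcedSolution A C u μ f x) (hy : IsForcedSolution A C u μ f y) :
    IsHomogeneousSolution A C u (fun t => x t - y t) := by
  obtain ⟨w, hw, hwx⟩ := hx
  obtain ⟨z, hz, hzy⟩ := hy
  have key : ∀ a b, a ≤ b → x b - y b - (x a - y a) = w b - z b - (w a - z a) := by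
    intro a b hab
    rw [sub_sub_sub_comm, hwx a b hab, hzy a b hab]
    abel
  obtain ⟨Φ₁, Φ₂, h1, h2, h⟩ := hw.sub hz
  refine ⟨Φ₁, Φ₂, by simpa only [map_sub] using h1, by simpa only [map_sub] using h2,
    fun a b => ?_⟩
  rw [← h]
  rcases le_total a b with hab | hab
  · exact key a b hab
  · have := congrArg Neg.neg (key b a hab)
    simpa only [neg_sub] using this

theorem IsForcedSolution.continuousWithinAt_Iic {μ : Measure ℝ} (hv : IsStieltjesMeasure u μ)
    {f x : ℝ → X} (hx : IsForcedSolution A C u μ f x) {B : ℝ} (hf : ∀ t, ‖f t‖ ≤ B) (t : ℝ) :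
    ContinuousWithinAt x (Iic t) t := by
  obtain ⟨w, hw, hwx⟩ := hx
  have h1 := hw.continuousWithinAt_Iic hv.left_continuous t
  have h2 : Tendsto (fun s => ∫ r in Ico s t, f r ∂μ) (𝓝[≤] t) (𝓝 0) := by
    refine squeeze_zero_norm' (a := fun s => B * (u t - u s)) ?_ ?_
    · filter_upwards [self_mem_nhdsWithin] with s hs
      rw [← hv.real_Ico hs]
      refine norm_setIntegral_le_of_norm_le_const ?_ fun r _ => hf r
      rw [hv.measure_Ico]; exact ENNReal.ofReal_lt_top
    · simpa using ((hv.left_continuous t).tendsto.const_sub (u t)).const_mul B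
  have h3 := (h1.tendsto.sub h2).add_const (x t - w t)
  rw [sub_zero, add_sub_cancel] at h3
  refine h3.congr' ?_
  filter_upwards [self_mem_nhdsWithin] with s hs
  have := hwx s t hs
  rw [sub_eq_iff_eq_add] at this
  rw [this]
  abel

/-- The dichotomy estimates for the fundamental operator `U`. -/
structure IsDichotomy (U : ℝ → ℝ → X →L[ℝ] X) (P : X →L[ℝ] X) (K α : ℝ) : Prop where
  K_pos : 0 < K
  α_pos : 0 < α
  stable : ∀ t s, s ≤ t → ‖U t 0 * P * U 0 s‖ ≤ K * Real.exp (-α * (t - s))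
  unstable : ∀ t s, t ≤ s → ‖U t 0 * (1 - P) * U 0 s‖ ≤ K * Real.exp (α * (t - s))

theorem IsDichotomy.stable_le (hd : IsDichotomy U P K α) {t s : ℝ} (h : s ≤ t) :
    ‖U t 0 * P * U 0 s‖ ≤ K := by
  refine (hd.stable t s h).trans (mul_le_of_le_one_right hd.K_pos.le (Real.exp_le_one_iff.2 ?_))
  have := mul_nonneg hd.α_pos.le (sub_nonneg.2 h)
  linarith

theorem IsDichotomy.unstable_le (hd : IsDichotomy U P K α) {t s : ℝ} (h : t ≤ s) :
    ‖U t 0 * (1 - P) * U 0 s‖ ≤ K := by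
  refine (hd.unstable t s h).trans (mul_le_of_le_one_right hd.K_pos.le (Real.exp_le_one_iff.2 ?_))
  have := mul_nonneg hd.α_pos.le (sub_nonneg.2 h)
  linarith

/-- A bounded solution of the homogeneous equation vanishes. -/
theorem IsAdmissible.bounded_eq_zero (h : IsAdmissible A C u hu)
    (hU : IsFundamentalOperator A C u U) (hd : IsDichotomy U P K α) {w : ℝ → X}
    (hw : IsHomogeneousSolution A C u w) {B : ℝ} (hB : ∀ t, ‖w t‖ ≤ B) (t : ℝ) : w t = 0 := by
  refine h.eq_zero hw (t₀ := 0) ?_ t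
  -- For `Q = 1 - P` the kernel decays as `t → +∞`, for `Q = P` as `t → -∞`. Since `w` is bounded,
  -- both parts of `w 0` vanish.
  have e : ∀ (Q : X →L[ℝ] X) (t : ℝ), (U 0 0 * Q * U 0 t) (w t) = Q (w 0) := by
    intro Q t
    rw [h.eq_fundamental hU hw t 0, hU.self, one_mul]
    rfl
  have hB0 : 0 ≤ B := (norm_nonneg _).trans (hB 0)
  have hexp : Tendsto (fun t : ℝ => K * Real.exp (-α * t) * B) atTop (𝓝 (K * 0 * B)) := by
    refine ((Real.tendsto_exp_atBot.comp ?_).const_mul K).mul_const B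
    exact tendsto_id.const_mul_atTop_of_neg (neg_lt_zero.2 hd.α_pos)
  rw [mul_zero, zero_mul] at hexp
  have h1 : (1 - P) (w 0) = 0 := by
    refine norm_le_zero_iff.1 (ge_of_tendsto hexp ?_)
    filter_upwards [eventually_ge_atTop 0] with t ht
    rw [← e (1 - P) t]
    refine (ContinuousLinearMap.le_opNorm _ _).trans ?_
    have := hd.unstable 0 t ht
    rw [show α * (0 - t) = -α * t by ring] at this
    exact mul_le_mul this (hB t) (norm_nonneg _) ((norm_nonneg _).trans this)
  have h2 : P (w 0) = 0 := by
    refine norm_le_zero_iff.1 (ge_of_tendsto hexp ?_)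
    filter_upwards [eventually_ge_atTop 0] with t ht
    rw [← e P (-t)]
    refine (ContinuousLinearMap.le_opNorm _ _).trans ?_
    have := hd.stable 0 (-t) (by linarith)
    rw [show -α * (0 - -t) = -α * t by ring] at this
    exact mul_le_mul this (hB (-t)) (norm_nonneg _) ((norm_nonneg _).trans this)
  have h3 : w 0 = (1 - P) (w 0) + P (w 0) := by simp
  rw [h3, h1, h2, add_zero]

/-- The coordinates, with respect to `U(·, 0)`, of the bounded solution with forcing term `f`. -/
def greenCoordinates (P : X →L[ℝ] X) (W : ℝ → X →L[ℝ] X) (μ : Measure ℝ) (f : ℝ → X) (t : ℝ) :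
    X :=
  (∫ s in Iio t, (P * W s) (f s) ∂μ) - ∫ s in Ici t, ((1 - P) * W s) (f s) ∂μ

variable {V W : ℝ → X →L[ℝ] X} {f g : ℝ → X} {μ : Measure ℝ}

theorem IsDichotomy.norm_le_of_lt (hd : IsDichotomy U P K α)
    (hW : ∀ t, Tendsto (fun r => U 0 r) (𝓝[>] t) (𝓝 (W t))) {s t : ℝ} (hst : s < t) :
    ‖U t 0 * P * W s‖ ≤ K := by
  refine le_of_tendsto ((hW s).const_mul (U t 0 * P)).norm ?_
  filter_upwards [Ioo_mem_nhdsGT hst] with r hr using hd.stable_le hr.2.le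

theorem IsDichotomy.norm_le_of_le (hd : IsDichotomy U P K α)
    (hW : ∀ t, Tendsto (fun r => U 0 r) (𝓝[>] t) (𝓝 (W t))) {s t : ℝ} (hst : t ≤ s) :
    ‖U t 0 * (1 - P) * W s‖ ≤ K := by
  refine le_of_tendsto ((hW s).const_mul (U t 0 * (1 - P))).norm ?_
  filter_upwards [self_mem_nhdsWithin] with r hr using hd.unstable_le (hst.trans (le_of_lt hr))

theorem IsForcing.aestronglyMeasurable_clm (hf : IsForcing μ f)
    (hW : ∀ t, Tendsto (fun r => U 0 r) (𝓝[>] t) (𝓝 (W t))) (Q : X →L[ℝ] X) :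
    AEStronglyMeasurable (fun s => (Q * W s) (f s)) μ :=
  (ContinuousLinearMap.id ℝ (X →L[ℝ] X)).aestronglyMeasurable_comp₂
    ((stronglyMeasurable_of_tendsto_nhdsGT hW).aestronglyMeasurable.const_mul Q) hf.1

variable [IsFiniteMeasure μ]

theorem IsForcing.integrableOn_stable (hf : IsForcing μ f) (hd : IsDichotomy U P K α)
    (hW : ∀ t, Tendsto (fun r => U 0 r) (𝓝[>] t) (𝓝 (W t))) (t : ℝ) :
    IntegrableOn (fun s => (U t 0 * P * W s) (f s)) (Iio t) μ := by
  obtain ⟨B, hB⟩ := hf.2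
  refine IntegrableOn.of_bound (measure_lt_top _ _) (hf.aestronglyMeasurable_clm hW _).restrict
    (K * B) ((ae_restrict_mem measurableSet_Iio).mono fun s hs => ?_)
  exact (ContinuousLinearMap.le_opNorm _ _).trans
    (mul_le_mul (hd.norm_le_of_lt hW hs) (hB s) (norm_nonneg _) hd.K_pos.le)

theorem IsForcing.integrableOn_unstable (hf : IsForcing μ f) (hd : IsDichotomy U P K α)
    (hW : ∀ t, Tendsto (fun r => U 0 r) (𝓝[>] t) (𝓝 (W t))) (t : ℝ) :
    IntegrableOn (fun s => (U t 0 * (1 - P) * W s) (f s)) (Ici t) μ := by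
  obtain ⟨B, hB⟩ := hf.2
  refine IntegrableOn.of_bound (measure_lt_top _ _) (hf.aestronglyMeasurable_clm hW _).restrict
    (K * B) ((ae_restrict_mem measurableSet_Ici).mono fun s hs => ?_)
  exact (ContinuousLinearMap.le_opNorm _ _).trans
    (mul_le_mul (hd.norm_le_of_le hW hs) (hB s) (norm_nonneg _) hd.K_pos.le)

theorem IsAdmissible.integrableOn_stable (h : IsAdmissible A C u hu)
    (hU : IsFundamentalOperator A C u U) (hf : IsForcing μ f) (hd : IsDichotomy U P K α)
    (hW : ∀ t, Tendsto (fun r => U 0 r) (𝓝[>] t) (𝓝 (W t))) (t : ℝ) :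
    IntegrableOn (fun s => (P * W s) (f s)) (Iio t) μ := by
  refine ((U 0 t).integrable_comp (hf.integrableOn_stable hd hW t)).congr
    (Eventually.of_forall fun s => ?_)
  change (U 0 t * (U t 0 * P * W s)) (f s) = _
  rw [← mul_assoc, ← mul_assoc, h.fundamental_mul_inv hU, one_mul]

theorem IsAdmissible.integrableOn_unstable (h : IsAdmissible A C u hu)
    (hU : IsFundamentalOperator A C u U) (hf : IsForcing μ f) (hd : IsDichotomy U P K α)
    (hW : ∀ t, Tendsto (fun r => U 0 r) (𝓝[>] t) (𝓝 (W t))) (t : ℝ) :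
    IntegrableOn (fun s => ((1 - P) * W s) (f s)) (Ici t) μ := by
  refine ((U 0 t).integrable_comp (hf.integrableOn_unstable hd hW t)).congr
    (Eventually.of_forall fun s => ?_)
  change (U 0 t * (U t 0 * (1 - P) * W s)) (f s) = _
  rw [← mul_assoc, ← mul_assoc, h.fundamental_mul_inv hU, one_mul]

theorem IsAdmissible.greenCoordinates_sub (h : IsAdmissible A C u hu)
    (hU : IsFundamentalOperator A C u U) (hd : IsDichotomy U P K α)
    (hW : ∀ t, Tendsto (fun r => U 0 r) (𝓝[>] t) (𝓝 (W t))) (hf : IsForcing μ f)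
    (hg : IsForcing μ g) (t : ℝ) : greenCoordinates P W μ (fun s => f s - g s) t
      = greenCoordinates P W μ f t - greenCoordinates P W μ g t := by
  simp only [greenCoordinates, map_sub]
  rw [integral_sub (h.integrableOn_stable hU hf hd hW t) (h.integrableOn_stable hU hg hd hW t),
    integral_sub (h.integrableOn_unstable hU hf hd hW t)
      (h.integrableOn_unstable hU hg hd hW t)]
  abel

/-- The kernel is bounded by `K` on each of the two half-lines, and their masses add up to that of
the line. -/
theorem IsAdmissible.norm_green_le [CompleteSpace X] (h : IsAdmissible A C u hu)
    (hU : IsFundamentalOperator A C u U) (hd : IsDichotomy U P K α)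
    (hW : ∀ t, Tendsto (fun r => U 0 r) (𝓝[>] t) (𝓝 (W t))) (hf : IsForcing μ f) {B : ℝ}
    (hB : ∀ t, ‖f t‖ ≤ B) (t : ℝ) :
    ‖U t 0 (greenCoordinates P W μ f t)‖ ≤ K * μ.real univ * B := by
  rw [greenCoordinates, map_sub,
    ← (U t 0).integral_comp_comm (h.integrableOn_stable hU hf hd hW t),
    ← (U t 0).integral_comp_comm (h.integrableOn_unstable hU hf hd hW t)]
  have h1 : ‖∫ s in Iio t, (U t 0) ((P * W s) (f s)) ∂μ‖ ≤ K * B * μ.real (Iio t) := by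
    refine norm_setIntegral_le_of_norm_le_const (measure_lt_top _ _) fun s hs => ?_
    change ‖(U t 0 * (P * W s)) (f s)‖ ≤ _
    rw [← mul_assoc]
    exact (ContinuousLinearMap.le_opNorm _ _).trans
      (mul_le_mul (hd.norm_le_of_lt hW hs) (hB s) (norm_nonneg _) hd.K_pos.le)
  have h2 : ‖∫ s in Ici t, (U t 0) (((1 - P) * W s) (f s)) ∂μ‖ ≤ K * B * μ.real (Ici t) := by
    refine norm_setIntegral_le_of_norm_le_const (measure_lt_top _ _) fun s hs => ?_
    change ‖(U t 0 * ((1 - P) * W s)) (f s)‖ ≤ _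
    rw [← mul_assoc]
    exact (ContinuousLinearMap.le_opNorm _ _).trans
      (mul_le_mul (hd.norm_le_of_le hW hs) (hB s) (norm_nonneg _) hd.K_pos.le)
  refine (norm_sub_le _ _).trans ((add_le_add h1 h2).trans (le_of_eq ?_))
  have h3 : μ.real univ = μ.real (Iio t) + μ.real (Ici t) := by
    rw [← measureReal_union _ measurableSet_Ici, Iio_union_Ici]
    exact (Iio_disjoint_Ici le_rfl)
  rw [h3]
  ring

/-- Going from `p` to `q` adds `[p, q)` to the stable integral and removes it from the subtracted
unstable one. As `P + (1 - P) = 1`, the increment no longer involves `P`. -/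
theorem IsAdmissible.greenCoordinates_increment (h : IsAdmissible A C u hu)
    (hU : IsFundamentalOperator A C u U) (hd : IsDichotomy U P K α)
    (hW : ∀ t, Tendsto (fun r => U 0 r) (𝓝[>] t) (𝓝 (W t))) (hf : IsForcing μ f) (p q : ℝ) :
    IntegrableOn (fun s => W s (f s)) (Ico p q) μ ∧ (p ≤ q →
      greenCoordinates P W μ f q - greenCoordinates P W μ f p
        = ∫ s in Ico p q, W s (f s) ∂μ) := by
  have hs := h.integrableOn_stable hU hf hd hW
  have hus := h.integrableOn_unstable hU hf hd hW
  have e : ∀ s, W s (f s) = (P * W s) (f s) + ((1 - P) * W s) (f s) := fun s => by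
    rw [← add_apply, ← add_mul, add_sub_cancel, one_mul]
  have i1 := (hs q).mono_set (Ico_subset_Iio_self (a := p))
  have i2 := (hus p).mono_set (t := Ici p) (s := Ico p q) Ico_subset_Ici_self
  refine ⟨(i1.add i2).congr (Eventually.of_forall fun s => (e s).symm), fun hpq => ?_⟩
  have e1 : ∫ s in Iio q, (P * W s) (f s) ∂μ
      = ∫ s in Iio p, (P * W s) (f s) ∂μ + ∫ s in Ico p q, (P * W s) (f s) ∂μ := by
    rw [← setIntegral_union _ measurableSet_Ico (hs p) i1, Iio_union_Ico_eq_Iio hpq]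
    exact Set.disjoint_left.2 fun x hx hx' => not_lt.2 hx'.1 hx
  have e2 : ∫ s in Ici p, ((1 - P) * W s) (f s) ∂μ
      = ∫ s in Ico p q, ((1 - P) * W s) (f s) ∂μ + ∫ s in Ici q, ((1 - P) * W s) (f s) ∂μ := by
    rw [← setIntegral_union _ measurableSet_Ici i2 (hus q), Ico_union_Ici_eq_Ici hpq]
    exact Set.disjoint_left.2 fun x hx hx' => not_lt.2 hx' hx.2
  simp only [e]
  rw [integral_add i1 i2, greenCoordinates, greenCoordinates, e1, e2]
  abel

/-- The Green function solves the forced equation. -/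
theorem IsAdmissible.isForcedSolution_green [CompleteSpace X] (h : IsAdmissible A C u hu)
    (hU : IsFundamentalOperator A C u U) (hd : IsDichotomy U P K α)
    (hV : ∀ t, Tendsto (fun r => U r 0) (𝓝[>] t) (𝓝 (V t)))
    (hW : ∀ t, Tendsto (fun r => U 0 r) (𝓝[>] t) (𝓝 (W t))) (hVW : ∀ t, V t * W t = 1)
    (hf : IsForcing μ f) :
    IsForcedSolution A C u μ f (fun t => U t 0 (greenCoordinates P W μ f t)) := by
  obtain ⟨Φ₁, Φ₂, h1, h2, hΦ⟩ := hU.isPrimitiveSum 0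
  set ξ := greenCoordinates P W μ f with hξdef
  have hφ : ∀ p q, IntegrableOn (fun s => W s (f s)) (Ico p q) μ := fun p q =>
    (h.greenCoordinates_increment hU hd hW hf p q).1
  have hξ : ∀ p q, p ≤ q → ξ q - ξ p = ∫ s in Ico p q, W s (f s) ∂μ := fun p q =>
    (h.greenCoordinates_increment hU hd hW hf p q).2
  have hr1 : ∀ t, ∃ L, Tendsto Φ₁ (𝓝[>] t) (𝓝 L) := fun t => ⟨_, h1.tendsto_nhdsGT (d := 0)
    (by simpa using (tendsto_id.mono_left nhdsWithin_le_nhds : Tendsto id (𝓝[>] t) (𝓝 t)))⟩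
  have hr2 : ∀ t, ∃ L, Tendsto Φ₂ (𝓝[>] t) (𝓝 L) := fun t => by
    obtain ⟨d, hd, -⟩ := h.exists_jump t
    exact ⟨_, h2.tendsto_nhdsGT hd⟩
  choose Φ₁' hr1 using hr1
  choose Φ₂' hr2 using hr2
  have k1 := fun a b (hab : a ≤ b) => h1.hasStieltjes_clm_apply
    (fun t => h1.continuousWithinAt_Iic continuousWithinAt_id) hr1 hφ hξ hab
  have k2 := fun a b (hab : a ≤ b) => h2.hasStieltjes_clm_apply
    (fun t => h2.continuousWithinAt_Iic (h.left_continuous t)) hr2 hφ hξ hab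
  obtain ⟨Ψ₁, hΨ₁⟩ := exists_hasPrimitive fun a b hab => ⟨_, (k1 a b hab).2⟩
  obtain ⟨Ψ₂, hΨ₂⟩ := exists_hasPrimitive fun a b hab => ⟨_, (k2 a b hab).2⟩
  refine ⟨fun t => Ψ₁ t + Ψ₂ t, ⟨Ψ₁, Ψ₂, hΨ₁, hΨ₂, fun a b => add_sub_add_comm _ _ _ _⟩, fun a b hab => ?_⟩
  have e1 := (hΨ₁ a b hab).unique hab (k1 a b hab).2
  have e2 := (hΨ₂ a b hab).unique hab (k2 a b hab).2
  -- The constant of integration between `U t 0` and the sum of the two primitives. It cancels at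
  -- the end.
  set D : X →L[ℝ] X := Φ₁ 0 + Φ₂ 0 - U 0 0 with hD
  have eU : ∀ t, Φ₁ t + Φ₂ t = U t 0 + D := by
    intro t
    have : U t 0 - U 0 0 = Φ₁ t - Φ₁ 0 + (Φ₂ t - Φ₂ 0) := hΦ 0 t
    rw [sub_eq_iff_eq_add] at this
    rw [hD, this]
    abel
  have eV : ∀ t, Φ₁' t + Φ₂' t = V t + D := by
    intro t
    refine tendsto_nhds_unique ((hr1 t).add (hr2 t)) ?_
    exact ((hV t).add_const D).congr fun r => (eU r).symm
  -- The correction term of the integration by parts: the right limits add up to `V + D`, and `V * W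
  -- = 1` turns it back into the forcing term.
  have eI : ∫ r in Ico a b, Φ₁' r (W r (f r)) ∂μ + ∫ r in Ico a b, Φ₂' r (W r (f r)) ∂μ
      = ∫ r in Ico a b, f r ∂μ + D (ξ b - ξ a) := by
    rw [hξ a b hab, ← D.integral_comp_comm (hφ a b),
      ← integral_add (k1 a b hab).1 (k2 a b hab).1,
      ← integral_add hf.integrable.integrableOn (D.integrable_comp (hφ a b))]
    congr 1
    funext r
    rw [← add_apply, eV, add_apply]
    congr 1
    change (V r * W r) (f r) = f r
    rw [hVW]
    rfl
  have eb : Φ₁ b (ξ b) + Φ₂ b (ξ b) = U b 0 (ξ b) + D (ξ b) := by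
    rw [← add_apply, eU, add_apply]
  have ea : Φ₁ a (ξ a) + Φ₂ a (ξ a) = U a 0 (ξ a) + D (ξ a) := by
    rw [← add_apply, eU, add_apply]
  have : Ψ₁ b + Ψ₂ b - (Ψ₁ a + Ψ₂ a) = (Φ₁ b (ξ b) + Φ₂ b (ξ b)) - (Φ₁ a (ξ a) + Φ₂ a (ξ a))
      - (∫ r in Ico a b, Φ₁' r (W r (f r)) ∂μ + ∫ r in Ico a b, Φ₂' r (W r (f r)) ∂μ) := by
    rw [add_sub_add_comm, e1, e2]
    abel
  rw [this, ea, eb, eI, map_sub]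
  abel

end Green

/-! ### Bounded solutions of the nonlinear equation by contraction -/

theorem aestronglyMeasurable_of_Ico {E : Type*} [NormedAddCommGroup E] {μ : Measure ℝ}
    {f : ℝ → E} (h : ∀ a b, a ≤ b → AEStronglyMeasurable f (μ.restrict (Ico a b))) :
    AEStronglyMeasurable f μ := by
  have hU : (⋃ n : ℕ, Ico (-(n : ℝ)) n) = univ := by
    refine eq_univ_of_forall fun t => ?_
    obtain ⟨n, hn⟩ := exists_nat_gt |t|
    have := abs_lt.1 hn
    exact mem_iUnion.2 ⟨n, this.1.le, this.2⟩
  rw [← Measure.restrict_univ (μ := μ), ← hU, aestronglyMeasurable_iUnion_iff]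
  exact fun n => h _ _ (by have : (0 : ℝ) ≤ n := Nat.cast_nonneg n; linarith)

theorem IsPerturbation.isForcing {X : Type*} [NormedAddCommGroup X] {u : ℝ → ℝ} {hu : Monotone u}
    {H : ℝ → X → X} {x : ℝ → X} {M L : ℝ} (hH : IsPerturbation H u hu M L)
    (hx : StronglyMeasurable x) : IsForcing (duMeasure u hu) (fun s => H s (x s)) :=
  ⟨aestronglyMeasurable_comp_lipschitz
    (fun z => aestronglyMeasurable_of_Ico fun a b _ => (hH.integrable z a b).1) hH.lipschitz hx,
    M, fun t => hH.bounded t _⟩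

section Solutions

variable {X : Type*} [NormedAddCommGroup X] [NormedSpace ℝ X] {A C : ℝ → X →L[ℝ] X} {u : ℝ → ℝ}
  {hu : Monotone u} {H : ℝ → X → X} {x : ℝ → X}

theorem lsIntegral_of_le {E : Type*} [NormedAddCommGroup E] [NormedSpace ℝ E] (f : ℝ → E)
    (μ : Measure ℝ) {a b : ℝ} (h : a ≤ b) : lsIntegral f μ a b = ∫ s in Ico a b, f s ∂μ := by
  simp [lsIntegral, h]

theorem lsIntegral_of_ge {E : Type*} [NormedAddCommGroup E] [NormedSpace ℝ E] (f : ℝ → E)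
    (μ : Measure ℝ) {a b : ℝ} (h : b ≤ a) : lsIntegral f μ a b = - ∫ s in Ico b a, f s ∂μ := by
  simp [lsIntegral, h]

theorem IsSolution.isForcing {M L : ℝ} (hH : IsPerturbation H u hu M L)
    (hx : IsSolution A C H u hu x) : IsForcing (duMeasure u hu) (fun s => H s (x s)) := by
  refine ⟨aestronglyMeasurable_of_Ico fun a b hab => ?_, M, fun t => hH.bounded t _⟩
  have := (hx a b).2.2.1
  rw [uIcc_of_le hab] at this
  exact (this.mono_set Ico_subset_Icc_self).1

theorem IsSolution.isForcedSolution (hx : IsSolution A C H u hu x) :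
    IsForcedSolution A C u (duMeasure u hu) (fun s => H s (x s)) x := by
  have h1 := hasPrimitive_psIntegral 0 fun t => (hx 0 t).1
  have h2 := hasPrimitive_psIntegral 0 fun t => (hx 0 t).2.1
  refine ⟨fun t => psIntegral (fun s => A s (x s)) id 0 t + psIntegral (fun s => C s (x s)) u 0 t,
    ⟨_, _, h1, h2, fun a b => add_sub_add_comm _ _ _ _⟩, fun a b hab => ?_⟩
  have h3 := (hx a b).2.2.2
  rw [lsIntegral_of_le _ _ hab, (h1.hasPSIntegral a b).psIntegral_eq,
    (h2.hasPSIntegral a b).psIntegral_eq] at h3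
  rw [h3, add_sub_add_comm]
  abel

theorem IsForcedSolution.isSolution [IsFiniteMeasure (duMeasure u hu)]
    (hx : IsForcedSolution A C u (duMeasure u hu) (fun s => H s (x s)) x)
    (hf : IsForcing (duMeasure u hu) (fun s => H s (x s))) : IsSolution A C H u hu x := by
  obtain ⟨w, ⟨Φ₁, Φ₂, h1, h2, hw⟩, hwx⟩ := hx
  intro a b
  refine ⟨⟨_, h1.hasPSIntegral a b⟩, ⟨_, h2.hasPSIntegral a b⟩, hf.integrable.integrableOn, ?_⟩
  rw [(h1.hasPSIntegral a b).psIntegral_eq, (h2.hasPSIntegral a b).psIntegral_eq,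
    add_assoc (x a), ← hw]
  rcases le_total a b with hab | hab
  · rw [lsIntegral_of_le _ _ hab, add_assoc, ← hwx a b hab, add_sub_cancel]
  · rw [lsIntegral_of_ge _ _ hab]
    have := hwx b a hab
    rw [sub_eq_iff_eq_add] at this
    rw [this]
    abel

theorem eq_of_norm_sub_le_mul {E : Type*} [NormedAddCommGroup E] {x y : ℝ → E} {q B : ℝ}
    (hq0 : 0 ≤ q) (hq : q < 1) (hB : ∀ t, ‖x t - y t‖ ≤ B)
    (h : ∀ D, (∀ t, ‖x t - y t‖ ≤ D) → ∀ t, ‖x t - y t‖ ≤ q * D) : x = y := by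
  have hn : ∀ n : ℕ, ∀ t, ‖x t - y t‖ ≤ q ^ n * B := by
    intro n
    induction n with
    | zero => simpa using hB
    | succ n ih =>
      intro t
      rw [pow_succ', mul_assoc]
      exact h _ ih t
  funext t
  have := (tendsto_pow_atTop_nhds_zero_of_lt_one hq0 hq).mul_const B
  rw [zero_mul] at this
  exact sub_eq_zero.1 (norm_le_zero_iff.1 (ge_of_tendsto' this fun n => hn n t))

/-- Existence and uniqueness of the bounded solution when the Green operator composed with the
perturbation is a contraction. -/
theorem IsAdmissible.existsUnique_bounded_solution [CompleteSpace X]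
    {U : ℝ → ℝ → X →L[ℝ] X} {P : X →L[ℝ] X} {K α M L : ℝ} (h : IsAdmissible A C u hu)
    (hU : IsFundamentalOperator A C u U) (hd : IsDichotomy U P K α)
    (hH : IsPerturbation H u hu M L) (hL : 0 ≤ L) [IsFiniteMeasure (duMeasure u hu)]
    (hq : K * (duMeasure u hu).real univ * L < 1) :
    ∃! x : ℝ → X, IsSolution A C H u hu x ∧ ∃ B : ℝ, ∀ t, ‖x t‖ ≤ B := by
  set μ := duMeasure u hu with hμ
  obtain ⟨V, W, hV, hW, hVW⟩ := h.exists_rightLimits hU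
  set T : (ℝ → X) → ℝ → X := fun f t => U t 0 (greenCoordinates P W μ f t) with hT
  set c := K * μ.real univ with hc
  have hc0 : 0 ≤ c := mul_nonneg hd.K_pos.le measureReal_nonneg
  set q := c * L with hqdef
  have hq0 : 0 ≤ q := mul_nonneg hc0 hL
  have hTle : ∀ {f g : ℝ → X}, IsForcing μ f → IsForcing μ g → ∀ {B}, (∀ t, ‖f t - g t‖ ≤ B) →
      ∀ t, ‖T f t - T g t‖ ≤ c * B := by
    intro f g hf hg B hB t
    simp only [hT]
    rw [← map_sub, ← h.greenCoordinates_sub hU hd hW hf hg]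
    exact h.norm_green_le hU hd hW (hf.sub hg) hB t
  have hTsol : ∀ {f : ℝ → X}, IsForcing μ f → IsForcedSolution A C u μ f (T f) := fun hf =>
    h.isForcedSolution_green hU hd hV hW hVW hf
  have hTsm : ∀ {f : ℝ → X}, IsForcing μ f → StronglyMeasurable (T f) := by
    intro f hf
    obtain ⟨B, hB⟩ := hf.2
    exact stronglyMeasurable_of_continuousWithinAt_Iic fun t =>
      (hTsol hf).continuousWithinAt_Iic h.isStieltjesMeasure hB t
  have hlip : ∀ {x y : ℝ → X}, IsForcing μ (fun s => H s (x s)) →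
      IsForcing μ (fun s => H s (y s)) → ∀ {D}, (∀ t, ‖x t - y t‖ ≤ D) →
      ∀ t, ‖T (fun s => H s (x s)) t - T (fun s => H s (y s)) t‖ ≤ q * D := by
    intro x y hx hy D hD t
    rw [hqdef, mul_assoc]
    exact hTle hx hy
      (fun t => (hH.lipschitz t _ _).trans (mul_le_mul_of_nonneg_left (hD t) hL)) t
  -- Picard iteration from `0`. `T` is controlled only on measurable bounded forcings, so
  -- measurability is carried along: each iterate is left-continuous and the limit is a pointwise
  -- limit of measurable functions.
  set z : ℕ → ℝ → X := fun n => (fun x => T fun s => H s (x s))^[n] 0 with hz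
  have hzs : ∀ n, z (n + 1) = T fun s => H s (z n s) := fun n => by
    simp only [hz, Function.iterate_succ_apply']
  have hzsm : ∀ n, StronglyMeasurable (z n) := by
    intro n
    induction n with
    | zero => exact stronglyMeasurable_const
    | succ n ih => rw [hzs]; exact hTsm (hH.isForcing ih)
  have hzf : ∀ n, IsForcing μ (fun s => H s (z n s)) := fun n => hH.isForcing (hzsm n)
  have hzd : ∀ n t, dist (z n t) (z (n + 1) t) ≤ c * M * q ^ n := by
    intro n
    induction n with
    | zero =>
      intro t
      rw [dist_comm, dist_eq_norm, pow_zero, mul_one, hzs]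
      have : z 0 t = 0 := rfl
      rw [this, sub_zero]
      exact h.norm_green_le hU hd hW (hzf 0) (fun t => hH.bounded t _) t
    | succ n ih =>
      intro t
      rw [dist_eq_norm, hzs, hzs (n + 1), pow_succ']
      refine (hlip (hzf n) (hzf (n + 1)) (fun t => by rw [← dist_eq_norm]; exact ih t) t).trans ?_
      exact le_of_eq (by ring)
  choose x hx using fun t => cauchySeq_tendsto_of_complete
    (cauchySeq_of_le_geometric q (c * M) hq fun n => hzd n t)
  have hxd : ∀ n t, dist (z n t) (x t) ≤ c * M * q ^ n / (1 - q) := fun n t =>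
    dist_le_of_le_geometric_of_tendsto q (c * M) hq (fun n => hzd n t) (hx t) n
  have hxsm : StronglyMeasurable x :=
    stronglyMeasurable_of_tendsto atTop hzsm (tendsto_pi_nhds.2 hx)
  have hxf := hH.isForcing hxsm
  have hfix : x = T fun s => H s (x s) := by
    funext t
    have h1 : Tendsto (fun n => z (n + 1) t) atTop (𝓝 (T (fun s => H s (x s)) t)) := by
      rw [tendsto_iff_norm_sub_tendsto_zero]
      refine squeeze_zero (fun _ => norm_nonneg _) (fun n => ?_)
        (g := fun n => q * (c * M * q ^ n / (1 - q))) ?_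
      · rw [hzs]
        exact hlip (hzf n) hxf (fun t => by rw [← dist_eq_norm]; exact hxd n t) t
      · have := ((((tendsto_pow_atTop_nhds_zero_of_lt_one hq0 hq).const_mul (c * M)).div_const
          (1 - q))).const_mul q
        simpa using this
    exact tendsto_nhds_unique ((tendsto_add_atTop_iff_nat 1).2 (hx t)) h1
  have hxb : ∀ t, ‖x t‖ ≤ c * M := fun t => by
    rw [hfix]
    exact h.norm_green_le hU hd hW hxf (fun t => hH.bounded t _) t
  refine ⟨x, ⟨?_, c * M, hxb⟩, ?_⟩
  · refine IsForcedSolution.isSolution ?_ hxf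
    have := hTsol hxf
    rwa [← hfix] at this
  · rintro y ⟨hy, B, hB⟩
    have hyf := hy.isForcing hH
    -- A bounded solution differs from the Green solution with its own forcing by a bounded
    -- homogeneous solution, which is zero.
    have hyT : ∀ t, y t = T (fun s => H s (y s)) t := by
      intro t
      refine sub_eq_zero.1 (h.bounded_eq_zero hU hd (hy.isForcedSolution.sub (hTsol hyf))
        (B := B + c * M) (fun t => (norm_sub_le _ _).trans (add_le_add (hB t) ?_)) t)
      exact h.norm_green_le hU hd hW hyf (fun t => hH.bounded t _) t
    refine eq_of_norm_sub_le_mul hq0 hq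
      (fun t => (norm_sub_le _ _).trans (add_le_add (hB t) (hxb t))) fun D hD t => ?_
    rw [hyT t, congrFun hfix t]
    exact hlip hyf hxf hD t

end Solutions

/-! ### Dichotomies with coefficients of bounded total variation -/

section FiniteVariation

variable {X : Type*} [NormedAddCommGroup X] [NormedSpace ℝ X] {A C : ℝ → X →L[ℝ] X} {u : ℝ → ℝ}
  {hu : Monotone u}

theorem measure_real_Ico_add {ν : Measure ℝ} (hν : ∀ a b, ν (Ico a b) ≠ ⊤) {a b c : ℝ}
    (hab : a ≤ b) (hbc : b ≤ c) : ν.real (Ico a b) + ν.real (Ico b c) = ν.real (Ico a c) := by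
  rw [← Ico_union_Ico_eq_Ico hab hbc, measureReal_union Ico_disjoint_Ico_same measurableSet_Ico
    (hν _ _) (hν _ _)]

theorem eVariationOn_ne_top_of_norm_sub_le {E : Type*} [NormedAddCommGroup E] {F : ℝ → E}
    {ν : Measure ℝ} (hν : ∀ a b, ν (Ico a b) ≠ ⊤)
    (hF : ∀ a b, a ≤ b → ‖F b - F a‖ ≤ ν.real (Ico a b)) (a b : ℝ) :
    eVariationOn F (Icc a b) ≠ ⊤ := by
  set ρ : ℝ → ℝ := fun t => ν.real (Ico a t) with hρ
  have hmono : MonotoneOn ρ (Icc a b) := fun p _ q _ hpq =>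
    measureReal_mono (Ico_subset_Ico_right hpq) (hν _ _)
  rcases lt_or_ge b a with hab | hab
  · rw [Icc_eq_empty hab.not_ge, eVariationOn.subsingleton _ subsingleton_empty]
    exact ENNReal.zero_ne_top
  refine ne_top_of_le_ne_top (b := ENNReal.ofReal (ρ b - ρ a)) ENNReal.ofReal_ne_top ?_
  have hρv := hmono.eVariationOn_eq (left_mem_Icc.2 hab) (right_mem_Icc.2 hab)
  rw [inter_self] at hρv
  rw [← hρv]
  refine iSup_le fun ⟨n, s, hs, hsI⟩ => le_trans (Finset.sum_le_sum fun i _ => ?_)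
    (eVariationOn.sum_le (n := n) hs hsI)
  have h1 := hF _ _ (hs (Nat.le_succ i))
  have h2 := measure_real_Ico_add hν (hsI i).1 (hs (Nat.le_succ i))
  rw [edist_dist, edist_dist, dist_eq_norm, Real.dist_eq]
  refine ENNReal.ofReal_le_ofReal (h1.trans ((le_of_eq ?_).trans (le_abs_self _)))
  simp only [hρ]
  linarith

/-- A homogeneous solution varies at most by its supremum times the variation of the coefficients. -/
theorem IsAdmissible.norm_sub_le_variation (h : IsAdmissible A C u hu) {y : ℝ → X}
    (hy : IsHomogeneousSolution A C u y) {a b M : ℝ} (hab : a ≤ b)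
    (hM : ∀ s ∈ Icc a b, ‖y s‖ ≤ M) :
    ‖y b - y a‖ ≤ M * (eVariationOn (coeffPrimitive A C u) (Icc a b)).toReal := by
  obtain ⟨ν, hν, hmaj, hF⟩ := h.exists_majorant
  have hfin := eVariationOn_ne_top_of_norm_sub_le hν hF a b
  have hl := hy.continuousWithinAt_Iic h.left_continuous
  have hy' := hy
  obtain ⟨Φ₁, Φ₂, h1, h2, hΦ⟩ := hy'
  have hM0 : 0 ≤ M := (norm_nonneg _).trans (hM a (left_mem_Icc.2 hab))
  -- The majorant serves here only to give `y` bounded variation, as `exists_gauge_clm_apply`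
  -- requires. It does not enter the final bound.
  have hρ : ∀ p q, a ≤ p → p ≤ q → q ≤ b →
      ‖y q - y p‖ ≤ M * ν.real (Ico a q) - M * ν.real (Ico a p) := by
    intro p q hp hpq hq
    rw [← measure_real_Ico_add hν hp hpq, mul_add, add_sub_cancel_left]
    exact hmaj y y hl hy p q M hpq fun s hs => hM s ⟨hp.trans hs.1, hs.2.trans hq⟩
  refine le_of_forall_pos_le_add fun ε hε => ?_
  have hε4 : 0 < ε / 4 := by positivity
  obtain ⟨δ₁, hδ₁, H₁⟩ := h.hasPrimitive_A.exists_gauge_clm_apply hab hρ hε4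
  obtain ⟨δ₂, hδ₂, H₂⟩ := h.hasPrimitive_C.exists_gauge_clm_apply hab hρ hε4
  obtain ⟨δ₃, hδ₃, H₃⟩ := h1 a b hab _ hε4
  obtain ⟨δ₄, hδ₄, H₄⟩ := h2 a b hab _ hε4
  -- One division fine for four gauges: two bring the tagged sums near the integrals of `A y` and `C
  -- y`, two bring them near the sums of increments of the coefficient primitive applied to `y`.
  obtain ⟨S, hS⟩ := exists_isFineSum (δ := fun t => min (min (δ₁ t) (δ₂ t)) (min (δ₃ t) (δ₄ t)))
    (fun t => lt_min (lt_min (hδ₁ t) (hδ₂ t)) (lt_min (hδ₃ t) (hδ₄ t)))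
    (stieltjesCell (fun s => A s (y s)) id) hab
  obtain ⟨n, s, τ, hD, -⟩ := isFineSum_iff.1 hS
  have k1 := H₁ n s τ (hD.mono fun t => (min_le_left _ _).trans (min_le_left _ _))
  have k2 := H₂ n s τ (hD.mono fun t => (min_le_left _ _).trans (min_le_right _ _))
  have k3 := H₃ n s τ (hD.mono fun t => (min_le_right _ _).trans (min_le_left _ _))
  have k4 := H₄ n s τ (hD.mono fun t => (min_le_right _ _).trans (min_le_right _ _))
  obtain ⟨h0, hn, hf⟩ := hD
  have hs : ∀ i < n, s i ≤ s (i + 1) := fun i hi => (hf i hi).1.trans (hf i hi).2.1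
  have hsmono : MonotoneOn s (Iic n) := by
    intro i _ j hj hij
    induction j, hij using Nat.le_induction with
    | base => exact le_rfl
    | succ k hk ih =>
      have hk1 : k + 1 ≤ n := hj
      exact (ih (by simp only [mem_Iic]; omega)).trans (hs k (by omega))
  have hsI : ∀ i ≤ n, s i ∈ Icc a b := fun i hi =>
    ⟨h0 ▸ hsmono (by simp) hi (Nat.zero_le i), hn ▸ hsmono hi (by simp) hi⟩
  set F := coeffPrimitive A C u with hFdef
  have k5 : ‖∑ i ∈ Finset.range n, (F (s (i + 1)) - F (s i)) (y (τ i))‖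
      ≤ M * (eVariationOn F (Icc a b)).toReal := by
    have e1 : ∑ i ∈ Finset.range n, ‖F (s (i + 1)) - F (s i)‖
        ≤ (eVariationOn F (Icc a b)).toReal := by
      rw [← ENNReal.ofReal_le_iff_le_toReal hfin,
        ENNReal.ofReal_sum_of_nonneg fun _ _ => norm_nonneg _]
      refine le_trans (le_of_eq ?_) (eVariationOn.sum_le_of_monotoneOn_Iic hsmono hsI)
      refine Finset.sum_congr rfl fun i _ => ?_
      rw [edist_dist, dist_eq_norm]
    calc _ ≤ ∑ i ∈ Finset.range n, M * ‖F (s (i + 1)) - F (s i)‖ := by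
          refine norm_sum_le_of_le _ fun i hi => ?_
          have hi := Finset.mem_range.1 hi
          rw [mul_comm]
          refine ((F (s (i + 1)) - F (s i)).le_opNorm _).trans ?_
          gcongr
          exact hM _ ⟨(hsI i hi.le).1.trans (hf i hi).1, (hf i hi).2.1.trans (hsI (i + 1) hi).2⟩
      _ ≤ _ := by rw [← Finset.mul_sum]; gcongr
  rw [hΦ a b]
  set S₁ := ∑ i ∈ Finset.range n, (id (s (i + 1)) - id (s i)) • A (τ i) (y (τ i)) with hS₁
  set S₂ := ∑ i ∈ Finset.range n, (u (s (i + 1)) - u (s i)) • C (τ i) (y (τ i)) with hS₂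
  set G₁ := ∑ i ∈ Finset.range n, (psIntegral A id 0 (s (i + 1)) - psIntegral A id 0 (s i)) (y (τ i))
    with hG₁
  set G₂ := ∑ i ∈ Finset.range n, (psIntegral C u 0 (s (i + 1)) - psIntegral C u 0 (s i)) (y (τ i))
    with hG₂
  rw [Finset.sum_sub_distrib] at k1 k2
  simp only [← sub_smul] at k3 k4
  have e2 : ∑ i ∈ Finset.range n, (F (s (i + 1)) - F (s i)) (y (τ i)) = G₁ + G₂ := by
    rw [hG₁, hG₂, ← Finset.sum_add_distrib]
    refine Finset.sum_congr rfl fun i _ => ?_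
    simp only [hFdef, coeffPrimitive]
    rw [add_sub_add_comm, add_apply]
  rw [e2] at k5
  have k1' : ‖S₁ - G₁‖ ≤ ε / 4 := k1
  have k2' : ‖S₂ - G₂‖ ≤ ε / 4 := k2
  have k3' : ‖S₁ - (Φ₁ b - Φ₁ a)‖ < ε / 4 := k3
  have k4' : ‖S₂ - (Φ₂ b - Φ₂ a)‖ < ε / 4 := k4
  calc ‖Φ₁ b - Φ₁ a + (Φ₂ b - Φ₂ a)‖ = ‖((S₁ - G₁) + (S₂ - G₂))
        - ((S₁ - (Φ₁ b - Φ₁ a)) + (S₂ - (Φ₂ b - Φ₂ a))) + (G₁ + G₂)‖ := by congr 1; abel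
    _ ≤ (ε / 4 + ε / 4) + (ε / 4 + ε / 4) + M * (eVariationOn F (Icc a b)).toReal := by
        refine norm_add_le_of_le (norm_sub_le_of_le ?_ ?_) k5
        · exact norm_add_le_of_le k1' k2'
        · exact norm_add_le_of_le k3'.le k4'.le
    _ = _ := by ring

/-- A dichotomy forces the coefficients to have infinite variation, unless the space is trivial. -/
theorem IsAdmissible.subsingleton_of_variation_le {U : ℝ → ℝ → X →L[ℝ] X} {P : X →L[ℝ] X}
    {K α R : ℝ} (h : IsAdmissible A C u hu) (hU : IsFundamentalOperator A C u U)
    (hd : IsDichotomy U P K α)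
    (hR : ∀ c d, c < d → (eVariationOn (coeffPrimitive A C u) (Icc c d)).toReal ≤ R) :
    Subsingleton X := by
  obtain ⟨ν, hν, -, hF⟩ := h.exists_majorant
  set F := coeffPrimitive A C u with hFdef
  have hfin : ∀ a b, eVariationOn F (Icc a b) ≠ ⊤ := eVariationOn_ne_top_of_norm_sub_le hν hF
  set φ : ℝ → ℝ → ℝ := fun c d => (eVariationOn F (Icc c d)).toReal with hφ
  have hadd : ∀ a b c, a ≤ b → b ≤ c → φ a b + φ b c = φ a c := by
    intro a b c hab hbc
    simp only [hφ]
    rw [← ENNReal.toReal_add (hfin _ _) (hfin _ _)]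
    have := eVariationOn.Icc_add_Icc F (s := univ) hab hbc (mem_univ _)
    simp only [univ_inter] at this
    rw [this]
  have hφ0 : ∀ a b, 0 ≤ φ a b := fun _ _ => ENNReal.toReal_nonneg
  -- An interval whose variation is within `1/2` of the supremum leaves at most `1/2` on either
  -- side.
  obtain ⟨T₁, T₂, hT, hT₁, hT₂⟩ : ∃ T₁ T₂, T₁ < T₂ ∧ (∀ t, t ≤ T₁ → φ t T₁ ≤ 1 / 2) ∧
      ∀ t, T₂ ≤ t → φ T₂ t ≤ 1 / 2 := by
    set Z : Set ℝ := {r | ∃ c d, c < d ∧ r = φ c d} with hZ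
    have hZb : BddAbove Z := ⟨R, by rintro _ ⟨c, d, hcd, rfl⟩; exact hR c d hcd⟩
    obtain ⟨_, ⟨c, d, hcd, rfl⟩, hlt⟩ := exists_lt_of_lt_csSup (s := Z) ⟨_, 0, 1, one_pos, rfl⟩
      (show sSup Z - 1 / 2 < sSup Z by linarith)
    refine ⟨c, d, hcd, fun t ht => ?_, fun t ht => ?_⟩
    · have h1 := le_csSup hZb ⟨t, d, ht.trans_lt hcd, rfl⟩
      have h2 := hadd t c d ht hcd.le
      linarith
    · have h1 := le_csSup hZb ⟨c, t, hcd.trans_le ht, rfl⟩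
      have h2 := hadd c d t hcd.le ht
      linarith
  have hexp : ∀ p : X, Tendsto (fun t : ℝ => K * Real.exp (-α * t) * ‖p‖) atTop (𝓝 0) := by
    intro p
    have : Tendsto (fun t : ℝ => K * Real.exp (-α * t) * ‖p‖) atTop (𝓝 (K * 0 * ‖p‖)) := by
      refine ((Real.tendsto_exp_atBot.comp ?_).const_mul K).mul_const _
      exact tendsto_id.const_mul_atTop_of_neg (neg_lt_zero.2 hd.α_pos)
    simpa using this
  have e : ∀ (Q : X →L[ℝ] X) (p : X) (t : ℝ), U t 0 (Q p) = (U t 0 * Q * U 0 0) p := by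
    intro Q p t
    rw [hU.self, mul_one]
    rfl
  have hP : ∀ p, P p = 0 := by
    intro p
    have hy := hU.isHomogeneousSolution 0 (P p)
    have hb : ∀ t, 0 ≤ t → ‖U t 0 (P p)‖ ≤ K * Real.exp (-α * t) * ‖p‖ := by
      intro t ht
      rw [e]
      have := hd.stable t 0 ht
      rw [sub_zero] at this
      exact (ContinuousLinearMap.le_opNorm _ _).trans (by gcongr)
    have hlim : Tendsto (fun t => U t 0 (P p)) atTop (𝓝 0) :=
      squeeze_zero_norm' ((eventually_ge_atTop 0).mono hb) (hexp p)
    -- Beyond `T₂` the solution tends to `0` and varies by at most half of any bound `M`. Comparison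
    -- with its limit at `+∞` replaces `M` by `M / 2`.
    have hz : U (max T₂ 0) 0 (P p) = 0 := by
      refine forall_eq_zero_of_half_bound (S := Ici (max T₂ 0)) (w := fun t => U t 0 (P p))
        (M₀ := K * ‖p‖) (fun t ht => ?_) (fun M hM t ht => ?_) _ self_mem_Ici
      · have ht0 : 0 ≤ t := (le_max_right _ _).trans ht
        refine (hb t ht0).trans ?_
        have h1 : Real.exp (-α * t) ≤ 1 := Real.exp_le_one_iff.2 (by
          have := mul_nonneg hd.α_pos.le ht0; linarith)
        have h2 := mul_nonneg hd.K_pos.le (norm_nonneg p)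
        nlinarith
      · have hM0 : 0 ≤ M := (norm_nonneg _).trans (hM t ht)
        have h3 : Tendsto (fun r => ‖U r 0 (P p) - U t 0 (P p)‖) atTop
            (𝓝 ‖0 - U t 0 (P p)‖) := (hlim.sub_const _).norm
        rw [zero_sub, norm_neg] at h3
        refine le_of_tendsto h3 ((eventually_ge_atTop t).mono fun r hr => ?_)
        refine (h.norm_sub_le_variation hy hr fun s hs => hM s (le_trans ht hs.1)).trans ?_
        have h4 : φ t r ≤ 1 / 2 := by
          have ht2 : T₂ ≤ t := (le_max_left _ _).trans ht
          have := hT₂ r (ht2.trans hr)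
          have := hadd T₂ t r ht2 hr
          linarith [hφ0 T₂ t]
        have : M * φ t r ≤ M * (1 / 2) := by gcongr
        linarith
    have := h.eq_zero hy hz 0
    rwa [hU.self] at this
  have hQ : ∀ p, (1 - P) p = 0 := by
    intro p
    have hy := hU.isHomogeneousSolution 0 ((1 - P) p)
    have hb : ∀ t, 0 ≤ t → ‖U (-t) 0 ((1 - P) p)‖ ≤ K * Real.exp (-α * t) * ‖p‖ := by
      intro t ht
      rw [e]
      have := hd.unstable (-t) 0 (by linarith)
      rw [show α * (-t - 0) = -α * t by ring] at this
      exact (ContinuousLinearMap.le_opNorm _ _).trans (by gcongr)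
    have hlim : Tendsto (fun t => U (-t) 0 ((1 - P) p)) atTop (𝓝 0) :=
      squeeze_zero_norm' ((eventually_ge_atTop 0).mono hb) (hexp p)
    -- The mirror argument: unstable solutions tend to `0` at `-∞`, where the remaining variation is
    -- again at most `1/2`.
    have hz : U (min T₁ 0) 0 ((1 - P) p) = 0 := by
      refine forall_eq_zero_of_half_bound (S := Iic (min T₁ 0)) (w := fun t => U t 0 ((1 - P) p))
        (M₀ := K * ‖p‖) (fun t ht => ?_) (fun M hM t ht => ?_) _ self_mem_Iic
      · have ht0 : 0 ≤ -t := neg_nonneg.2 (le_trans ht (min_le_right _ _))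
        have h0 := hb (-t) ht0
        rw [neg_neg] at h0
        refine h0.trans ?_
        have h1 : Real.exp (-α * -t) ≤ 1 := Real.exp_le_one_iff.2 (by
          have := mul_nonneg hd.α_pos.le ht0; linarith)
        have h2 := mul_nonneg hd.K_pos.le (norm_nonneg p)
        nlinarith
      · have hM0 : 0 ≤ M := (norm_nonneg _).trans (hM t ht)
        have h3 : Tendsto (fun r => ‖U t 0 ((1 - P) p) - U (-r) 0 ((1 - P) p)‖) atTop
            (𝓝 ‖U t 0 ((1 - P) p) - 0‖) := (hlim.const_sub _).norm
        rw [sub_zero] at h3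
        refine le_of_tendsto h3 ((eventually_ge_atTop (-t)).mono fun r hr => ?_)
        have hrt : -r ≤ t := by linarith
        refine (h.norm_sub_le_variation hy hrt fun s hs => hM s (le_trans hs.2 ht)).trans ?_
        have h4 : φ (-r) t ≤ 1 / 2 := by
          have ht2 : t ≤ T₁ := le_trans ht (min_le_left _ _)
          have := hT₁ (-r) (hrt.trans ht2)
          have := hadd (-r) t T₁ hrt ht2
          linarith [hφ0 t T₁]
        have : M * φ (-r) t ≤ M * (1 / 2) := by gcongr
        linarith
    have := h.eq_zero hy hz 0
    rwa [hU.self] at this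
  refine ⟨fun p r => ?_⟩
  have hzero : ∀ p : X, p = 0 := fun p => by
    have := hQ p
    rw [sub_apply, hP p, sub_zero] at this
    exact this
  rw [hzero p, hzero r]

end FiniteVariation

/-! ### Total mass of `du` and the two smallness conditions -/

theorem duMeasure_univ_le {u : ℝ → ℝ} {hu : Monotone u}
    (hv : IsStieltjesMeasure u (duMeasure u hu)) :
    duMeasure u hu univ ≤ totalVariation u := by
  have hU : (⋃ n : ℕ, Ico (-(n : ℝ)) n) = univ := by
    refine eq_univ_of_forall fun t => ?_
    obtain ⟨n, hn⟩ := exists_nat_gt |t|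
    have := abs_lt.1 hn
    exact mem_iUnion.2 ⟨n, this.1.le, this.2⟩
  have hmono : Monotone fun n : ℕ => Ico (-(n : ℝ)) n := by
    intro m n hmn
    have : (m : ℝ) ≤ n := by exact_mod_cast hmn
    exact Ico_subset_Ico (by linarith) this
  rw [← hU, hmono.measure_iUnion]
  refine iSup_le fun n => ?_
  rw [hv.measure_Ico]
  rcases Nat.eq_zero_or_pos n with rfl | hn
  · simp
  have hn' : (0 : ℝ) < n := by exact_mod_cast hn
  have hlt : -(n : ℝ) < n := by linarith
  refine le_trans ?_ (le_iSup_of_le (-(n : ℝ)) (le_iSup_of_le (n : ℝ)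
    (le_iSup_of_le hlt le_rfl)))
  refine le_trans (le_of_eq ?_) (eVariationOn.edist_le u (right_mem_Icc.2 hlt.le)
    (left_mem_Icc.2 hlt.le))
  rw [edist_dist, Real.dist_eq, abs_of_nonneg (sub_nonneg.2 (hu hlt.le))]

theorem theorem6p5 (K Cg Vu : ℝ) (hCg : 0 < Cg) (hVu : 0 ≤ Vu) :
    ∃ L₀ : ℝ, 0 < L₀ ∧
      ∀ (X : Type*) [NormedAddCommGroup X] [NormedSpace ℝ X] [CompleteSpace X]
        (A C : ℝ → X →L[ℝ] X) (u : ℝ → ℝ) (hu : Monotone u) (P : X →L[ℝ] X) (α : ℝ)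
        (H : ℝ → X → X) (Mh Lh : ℝ),
        IsAdmissible A C u hu →
        HasExponentialDichotomy A C u P K α →
        InverseJumpsBounded C u Cg →
        totalVariation u = ENNReal.ofReal Vu →
        0 < Mh → 0 ≤ Lh → IsPerturbation H u hu Mh Lh →
        (Lh ≤ L₀ ∨
          ∀ c d : ℝ, c < d →
            2 * Lh * Vu * (1 + K * (1 + 2 * K) * Cg ^ 3
              * Real.exp (3 * Cg * (eVariationOn (coeffPrimitive A C u) (Icc c d)).toReal)
              * (eVariationOn (coeffPrimitive A C u) (Icc c d)).toReal ^ 2) < 1) →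
        ∃! x : ℝ → X, IsSolution A C H u hu x ∧ ∃ B : ℝ, ∀ t, ‖x t‖ ≤ B := by
  -- Chosen so that `K * Vu * L₀ < 1`. The absolute value and the added ones keep the denominator
  -- positive before `0 < K` is known.
  refine ⟨1 / (2 * (|K| + 1) * (Vu + 1)), by positivity, ?_⟩
  intro X _ _ _ A C u hu P α H Mh Lh h hdich _ htv _ hLh hH hsmall
  obtain ⟨-, hK, hα, U, hU, hst, hun⟩ := hdich
  have hd : IsDichotomy U P K α := ⟨hK, hα, hst, hun⟩
  have hμ := duMeasure_univ_le h.isStieltjesMeasure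
  rw [htv] at hμ
  have : IsFiniteMeasure (duMeasure u hu) := ⟨hμ.trans_lt ENNReal.ofReal_lt_top⟩
  have hμr : (duMeasure u hu).real univ ≤ Vu := ENNReal.toReal_le_of_le_ofReal hVu hμ
  have hle : K * (duMeasure u hu).real univ * Lh ≤ K * Vu * Lh := by gcongr
  rcases hsmall with hsmall | hsmall
  · refine h.existsUnique_bounded_solution hU hd hH hLh (hle.trans_lt ?_)
    rw [abs_of_pos hK, le_div_iff₀ (by positivity)] at hsmall
    nlinarith [mul_nonneg hLh hVu, mul_nonneg hLh hK.le, mul_nonneg (mul_nonneg hLh hK.le) hVu]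
  -- If `Lh * Vu = 0` the contraction factor is zero. Otherwise the condition bounds the variation
  -- on every interval, so the space is trivial.
  · rcases (mul_nonneg hLh hVu).eq_or_lt with h0 | h0
    · refine h.existsUnique_bounded_solution hU hd hH hLh (hle.trans_lt ?_)
      rw [mul_assoc, mul_comm Vu, ← h0, mul_zero]
      exact one_pos
    · set κ := 2 * Lh * Vu * (K * (1 + 2 * K) * Cg ^ 3) with hκ
      have hκ0 : 0 < κ := by
        have : 0 < 2 * Lh * Vu := by linarith
        positivity
      have : Subsingleton X := by
        refine h.subsingleton_of_variation_le hU hd (R := 1 + 1 / κ) fun c d hcd => ?_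
        have h1 := hsmall c d hcd
        set r := (eVariationOn (coeffPrimitive A C u) (Icc c d)).toReal with hr
        have hr0 : 0 ≤ r := ENNReal.toReal_nonneg
        have hexp : 1 ≤ Real.exp (3 * Cg * r) := Real.one_le_exp (by positivity)
        have h2 : κ * r ^ 2 < 1 := by
          have h3 : κ * r ^ 2 * 1 ≤ κ * r ^ 2 * Real.exp (3 * Cg * r) := by gcongr
          have h4 : 2 * Lh * Vu * (1 + K * (1 + 2 * K) * Cg ^ 3 * Real.exp (3 * Cg * r) * r ^ 2)
              = 2 * (Lh * Vu) + κ * r ^ 2 * Real.exp (3 * Cg * r) := by rw [hκ]; ring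
          linarith
        -- If `r > 1 + 1 / κ`, then `r ^ 2 ≥ r > 1 / κ`, contradicting `κ * r ^ 2 < 1`.
        by_contra! hlt
        have hκi : 0 < 1 / κ := by positivity
        have h5 : κ * (1 / κ) = 1 := mul_one_div_cancel hκ0.ne'
        have h6 : r ≤ r ^ 2 := by nlinarith
        have h7 : κ * (1 / κ) ≤ κ * r ^ 2 := by
          gcongr
          linarith
        linarith
      -- On the trivial space `H` has Lipschitz constant `0`, so the contraction theorem applies
      -- without any smallness.
      have hH0 : IsPerturbation H u hu Mh 0 :=
        ⟨hH.integrable, hH.map_zero, hH.bounded, fun t x y => by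
          rw [Subsingleton.elim x y, sub_self, norm_zero, zero_mul]⟩
      refine h.existsUnique_bounded_solution hU hd hH0 le_rfl ?_
      rw [mul_zero]
      exact one_pos

end
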